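/- For a group $\Gamma$, say that $\Gamma$ is *Jordan* if there is a positive integer $m$ such that every finite subgroup $G\subset\Gamma$ contains a normal abelian subgroup $A\triangleleft G$ of index at most $m$; the least such $m$ is the *Jordan constant* $\mathrm J(\Gamma)$. Let $k$ be an algebraically closed field of characteristic $0$. Let $X$ be a smooth rational surface over $k$ (an integral separated $k$-scheme of finite type, smooth of relative dimension $2$, and birational over $k$ to an affine space), and let $B$ be a $k$-scheme isomorphic to $\mathbb P^1_k$. Let $\pi\colon X\to B$ be a conic bundle structure, that is, a $k$-morphism such that for every point $b\in B$ the scheme-theoretic fibre $X_b$ is isomorphic over the residue field $\kappa(b)$ to a reduced conic, i.e. to a reduced closed subscheme of $\mathbb P^2_{\kappa(b)}$ defined by a nonzero quadratic form. Let $\mathrm{Aut}(X,\pi)$ be the group of those $k$-automorphisms $g$ of $X$ for which there is a $k$-automorphism $h$ of $B$ with $\pi\circ g=h\circ\pi$. Then $\mathrm{Aut}(X,\pi)$ is Jordan and $$\mathrm J(\mathrm{Aut}(X,\pi))\le 7200 .$$ Equivalently, every finite subgroup of $\mathrm{Aut}(X,\pi)$ has a normal abelian subgroup of index at most $7200$.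 -/

import Mathlib

open CategoryTheory AlgebraicGeometry

universe u

/-! ### Jordan groups -/

/-- Every finite subgroup `G` of `Γ` contains a normal abelian subgroup of index at most `m`. -/
def JordanBound (Γ : Type*) [Group Γ] (m : ℕ) : Prop :=
  ∀ G : Subgroup Γ, Finite G →
    ∃ A : Subgroup G, A.Normal ∧ IsMulCommutative A ∧ A.index ≤ m

/-- A group is Jordan if some positive integer bounds, for all of its finite subgroups, the
minimal index of a normal abelian subgroup. -/
def IsJordanGroup (Γ : Type*) [Group Γ] : Prop :=
  ∃ m : ℕ, 0 < m ∧ JordanBound Γ m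

/-- The Jordan constant of a Jordan group: the least positive integer `m` such that every finite
subgroup contains a normal abelian subgroup of index at most `m`.
(It is meaningful only for Jordan groups.) -/
noncomputable def jordanConstant (Γ : Type*) [Group Γ] : ℕ :=
  sInf {m : ℕ | 0 < m ∧ JordanBound Γ m}

/-! ### Quotients of graded algebras by homogeneous ideals -/

section QuotientGrading

variable {K A : Type u} [CommRing K] [CommRing A] [Algebra K A] (𝒜 : ℕ → Submodule K A)

/-- The grading on `A ⧸ I` by the images of the graded pieces of `A`. -/
def quotientGrading (I : Ideal A) (n : ℕ) : Submodule K (A ⧸ I) :=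
  (𝒜 n).map (Ideal.Quotient.mkₐ K I).toLinearMap

/-- The projection of a graded piece of `A` onto the corresponding piece of `A ⧸ I`. -/
def quotientGradingProj (I : Ideal A) (n : ℕ) : 𝒜 n →+ quotientGrading 𝒜 I n where
  toFun a := ⟨Ideal.Quotient.mk I a, Submodule.mem_map_of_mem a.2⟩
  map_zero' := by ext; simp
  map_add' a b := by ext; simp

/-- If `I` is homogeneous, the images of the graded pieces of `A` make `A ⧸ I` a graded
algebra. -/
@[reducible]
noncomputable def quotientGradedAlgebra [GradedAlgebra 𝒜] (I : Ideal A)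
    (hI : I.IsHomogeneous 𝒜) : GradedAlgebra (quotientGrading 𝒜 I) where
  one_mem := ⟨1, SetLike.GradedOne.one_mem, by simp⟩
  mul_mem := by
    rintro i j _ _ ⟨a, ha, rfl⟩ ⟨b, hb, rfl⟩
    exact ⟨a * b, SetLike.GradedMul.mul_mem ha hb, by simp⟩
  toDecomposition := by
    let D : A →+ DirectSum ℕ fun n => quotientGrading 𝒜 I n :=
      (DirectSum.map (quotientGradingProj 𝒜 I)).comp
        (DirectSum.decomposeAddEquiv 𝒜).toAddMonoidHom
    have hD : ∀ a ∈ I, D a = 0 := by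
      intro a ha
      refine DFinsupp.ext fun n => Subtype.ext ?_
      exact Ideal.Quotient.eq_zero_iff_mem.2 (hI n ha)
    refine DirectSum.Decomposition.ofAddHom _
      (QuotientAddGroup.lift I.toAddSubgroup D hD) ?_ ?_
    · ext x
      obtain ⟨a, rfl⟩ := Ideal.Quotient.mk_surjective x
      change DirectSum.coeAddMonoidHom (quotientGrading 𝒜 I) (D a) = Ideal.Quotient.mk I a
      induction a using DirectSum.Decomposition.inductionOn 𝒜 with
      | zero => simp
      | homogeneous a => simp [D, quotientGradingProj]
      | add a b ha hb => simp [ha, hb]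
    · ext n ⟨_, a, ha, rfl⟩ : 2
      lift a to 𝒜 n using ha
      have h₁ : DirectSum.coeAddMonoidHom (quotientGrading 𝒜 I)
          (DirectSum.of _ n (quotientGradingProj 𝒜 I n a)) = Ideal.Quotient.mk I a := by
        rw [DirectSum.coeAddMonoidHom_of]; rfl
      have h₂ : D a = DirectSum.of _ n (quotientGradingProj 𝒜 I n a) := by
        simp [D]
      exact (congrArg (QuotientAddGroup.lift I.toAddSubgroup D hD) h₁).trans h₂

end QuotientGrading

/-! ### Projective schemes over a field -/

section Projective

/-- `Proj` of a graded `K`-algebra, as a scheme over `Spec K`. -/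
noncomputable def projOver {K A : Type u} [CommRing K] [CommRing A] [Algebra K A]
    (𝒜 : ℕ → Submodule K A) [GradedAlgebra 𝒜] : Over (Spec (.of K)) :=
  Over.mk (Proj.toSpecZero 𝒜 ≫ Spec.map (CommRingCat.ofHom (algebraMap K (𝒜 0))))

attribute [local instance] MvPolynomial.gradedAlgebra

/-- The projective line `ℙ¹` over `K`, as a scheme over `Spec K`. -/
noncomputable def projectiveLine (K : Type u) [Field K] : Over (Spec (.of K)) :=
  projOver (MvPolynomial.homogeneousSubmodule (Fin 2) K)

/-- The closed subscheme `q = 0` of the projective plane over `K`, for a form `q` of degree 2 in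
three variables: this is `Proj (K[x₀, x₁, x₂] / (q))`, as a scheme over `Spec K`. -/
noncomputable def planeConic {K : Type u} [Field K]
    (q : MvPolynomial.homogeneousSubmodule (Fin 3) K 2) : Over (Spec (.of K)) :=
  letI := quotientGradedAlgebra (MvPolynomial.homogeneousSubmodule (Fin 3) K)
    (Ideal.span {(q : MvPolynomial (Fin 3) K)})
    (Ideal.homogeneous_span _ _ (by rintro _ rfl; exact ⟨2, q.2⟩))
  projOver (quotientGrading (MvPolynomial.homogeneousSubmodule (Fin 3) K)
    (Ideal.span {(q : MvPolynomial (Fin 3) K)}))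

end Projective

/-- A scheme over a field `K` is a reduced conic if it is isomorphic over `K` to a closed
subscheme `q = 0` of the projective plane, with `q` a nonzero quadratic form, and this
subscheme is reduced. -/
def IsReducedConic {K : Type u} [Field K] (Y : Over (Spec (.of K))) : Prop :=
  ∃ q : MvPolynomial.homogeneousSubmodule (Fin 3) K 2,
    q ≠ 0 ∧ IsReduced (planeConic q).left ∧ Nonempty (Y ≅ planeConic q)

/-! ### Surfaces and conic bundles -/

/-- A smooth surface over `k`: an integral separated scheme of finite type over `k`, smooth of
relative dimension 2. -/
structure IsSmoothSurface {k : Type u} [Field k] (X : Over (Spec (.of k))) : Prop where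
  isIntegral : IsIntegral X.left
  isSeparated : IsSeparated X.hom
  quasiCompact : QuasiCompact X.hom
  smooth : SmoothOfRelativeDimension 2 X.hom

/-- A `k`-morphism `π : X ⟶ B` is a conic bundle structure if its scheme-theoretic fibre over
each point `b` of `B` is a reduced conic over the residue field of `b`. -/
def IsConicBundle {k : Type u} [Field k] {X B : Over (Spec (.of k))} (π : X ⟶ B) : Prop :=
  ∀ b : B.left,
    IsReducedConic (K := B.left.residueField b) (Over.mk (π.left.fiberToSpecResidueField b))

/-- `Aut(X, π)`: the group of the automorphisms of `X` over the base that preserve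
`π : X ⟶ B`, that is, lie over an automorphism of `B`. -/
def autPreserving {S : Scheme.{u}} {X B : Over S} (π : X ⟶ B) : Subgroup (Aut X) where
  carrier := {g | ∃ h : Aut B, g.hom ≫ π = π ≫ h.hom}
  one_mem' := ⟨1, (Category.id_comp π).trans (Category.comp_id π).symm⟩
  mul_mem' := by
    rintro g g' ⟨h, hh⟩ ⟨h', hh'⟩
    refine ⟨h * h', ?_⟩
    change (Iso.hom g' ≫ Iso.hom g) ≫ π = π ≫ Iso.hom h' ≫ Iso.hom h
    rw [Category.assoc, hh, ← Category.assoc, hh', Category.assoc]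
  inv_mem' := by
    rintro g ⟨h, hh⟩
    refine ⟨h⁻¹, ?_⟩
    change Iso.inv g ≫ π = π ≫ Iso.inv h
    refine (Iso.inv_comp_eq (α := g)).2 ?_
    rw [← Category.assoc]
    exact (Iso.eq_comp_inv (α := h)).2 hh.symm

/-!
Let `x` be the generic point of `X`, let `L = κ(x)` be its residue field, and let `K = κ(π x)`. A
finite group `G` of automorphisms of `X` preserving `π` acts faithfully on `L`, since `X` is reduced
and separated, and it preserves `K` (`exists_functionField_action`,
`exists_apply_residueFieldMap_eq`). As `B ≅ ℙ¹`, the field `K` is generated by one element over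
`k`. The rest of the argument takes place in these fields.

*The generic fibre.* The point `x` is the generic point of the fibre over `π x`, which is a conic
`q = 0` over `K`. This gives homogeneous coordinates `u` in `L` of the generic point of the conic:
they generate `L`, they satisfy `q(u) = 0`, and a form vanishing at `u` is divisible by `q` up to a
power of a coordinate (`exists_homogeneous_coordinates`). By Tsen's theorem, here in the form of
Legendre's descent, `q` has a zero over `K` (`exists_isotropic`). Projecting the conic from it shows
that `L = F(t)` for an extension `F` of `K` of degree at most two and an element `t` transcendental
over `F`; the degree is one unless `q` is a pair of lines (`exists_generator_of_conic`). Being the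
algebraic closure of `K` in `L`, the field `F` is preserved by `G`.

*The two Möbius groups.* Let `N ≤ M` be the kernels of the actions of `G` on `F` and on `K`. Then
`M / N` has order at most two, while `N` and `Q = G / M` are finite groups of automorphisms of
`F(t) / F` and of `K / k`. Both embed into `PGL₂` over an algebraically closed field, where every
nontrivial element of finite order fixes exactly two points of the projective line and where the
finite subgroups of a point stabiliser are cyclic. Burnside's orbit count then shows
(`FixesTwoPoints.dichotomy`) that such a group either has a cyclic subgroup of index at most two, or
has order `12`, `24` or `60`, in which case it is generated by two elements and its centre is
trivial. In the first case for `N`, and `|N| > 4`, let `c` generate the rotation subgroup. Every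
conjugate of `c` under `G` is a rotation with the same value of `tr² / det`, because that value is
`ζ + ζ⁻¹ + 2` for a root of unity `ζ`, hence lies in `k` and is fixed by `G`. So every
element of `G` centralises or inverts `c` (`fibreType_ker`).

*The bound.* If `|Q| ≤ 60`, then `[G : N] ≤ 120`, and one of the subgroups `1`, `N`, `⟨c⟩` has
index at most `120 · 60 = 7200`. Otherwise `Q` has a cyclic subgroup of index at most two, with
preimage `P` in `G`. If `N` is polyhedral, then `P / N` is abelian and `N` has trivial centre, so
that `P ∩ C_G(N)` is abelian; since `N` is generated by two elements and each of them has at most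
`60` conjugates, its index is at most `2 · 60² = 7200`. In the remaining cases let `E` be `N` or
`⟨c⟩`, an abelian normal subgroup that is its own centraliser in `N`, and let `W = C_G(E) ∩ M`. Then
`P ∩ C_G(W)` is abelian, and its index is small because `C_G(E)` has small index and because `W` is
generated by `E` and at most one further element (`exists_abelian_of_self_centralizing`).
-/


/-! ### Finite groups whose nontrivial elements fix exactly two points -/

section FixesTwo

open MulAction

/-- Every nontrivial element of `H` fixes exactly two points of `Ω`. -/
def FixesTwoPoints (H Ω : Type*) [Group H] [MulAction H Ω] : Prop :=
  ∀ h : H, h ≠ 1 → (fixedBy Ω h).ncard = 2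

/-- The solutions of `1/e₀ + 1/e₁ + 1/e₂ = 1 + 2/n` with every `n/eᵢ ≥ 3`. -/
lemma triangle_numbers {n : ℕ} {o e : Fin 3 → ℕ} (hoe : ∀ i, o i * e i = n)
    (he : ∀ i, 2 ≤ e i) (ho : ∀ i, 3 ≤ o i) (hsum : o 0 + o 1 + o 2 = n + 2) :
    ∃ m, (m = 3 ∧ n = 12 ∨ m = 4 ∧ n = 24 ∨ m = 5 ∧ n = 60) ∧ (∀ i, e i ≤ m) ∧ ∃ i, e i = m := by
  have key : ∀ a b c x y z : ℕ, a * x = n → b * y = n → c * z = n → 2 ≤ x → x ≤ y → y ≤ z →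
      3 ≤ c → a + b + c = n + 2 →
      (z = 3 ∧ n = 12 ∨ z = 4 ∧ n = 24 ∨ z = 5 ∧ n = 60) := by
    intro a b c x y z ha hb hc hx hxy hyz hc3 hs
    have hx2 : x = 2 := by
      by_contra h
      have h1 : a * 3 ≤ n := ha ▸ Nat.mul_le_mul_left a (by omega)
      have h2 : b * 3 ≤ n := hb ▸ Nat.mul_le_mul_left b (by omega)
      have h3 : c * 3 ≤ n := hc ▸ Nat.mul_le_mul_left c (by omega)
      omega
    subst hx2
    have hy3 : y = 3 := by
      by_contra h
      rcases Nat.lt_or_ge y 3 with h' | h'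
      · obtain rfl : y = 2 := by omega
        omega
      · have h2 : b * 4 ≤ n := hb ▸ Nat.mul_le_mul_left b (by omega)
        have h3 : c * 4 ≤ n := hc ▸ Nat.mul_le_mul_left c (by omega)
        omega
    subst hy3
    have hz : z ≤ 5 := by
      by_contra h
      have h3 : c * 6 ≤ n := hc ▸ Nat.mul_le_mul_left c (by omega)
      omega
    interval_cases z <;> omega
  have h0 := hoe 0
  have h1 := hoe 1
  have h2 := hoe 2
  have fin : ∀ i : Fin 3, (∀ j, e j ≤ e i) →
      (e i = 3 ∧ n = 12 ∨ e i = 4 ∧ n = 24 ∨ e i = 5 ∧ n = 60) →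
      ∃ m, (m = 3 ∧ n = 12 ∨ m = 4 ∧ n = 24 ∨ m = 5 ∧ n = 60) ∧ (∀ i, e i ≤ m) ∧ ∃ i, e i = m :=
    fun i hi h => ⟨e i, h, hi, i, rfl⟩
  have e3 : ∀ {p : ℕ}, e 0 ≤ p → e 1 ≤ p → e 2 ≤ p → ∀ j, e j ≤ p := by
    intro p a b c j; fin_cases j <;> assumption
  rcases le_total (e 0) (e 1) with a | a <;> rcases le_total (e 1) (e 2) with b | b <;>
    rcases le_total (e 0) (e 2) with c | c
  · exact fin 2 (e3 c b le_rfl) (key _ _ _ _ _ _ h0 h1 h2 (he 0) a b (ho 2) (by omega))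
  · exact fin 2 (e3 (a.trans b) b le_rfl)
      (key _ _ _ _ _ _ h0 h1 h2 (he 0) a b (ho 2) (by omega))
  · exact fin 1 (e3 a le_rfl b) (key _ _ _ _ _ _ h0 h2 h1 (he 0) c b (ho 1) (by omega))
  · exact fin 1 (e3 a le_rfl b) (key _ _ _ _ _ _ h2 h0 h1 (he 2) c a (ho 1) (by omega))
  · exact fin 2 (e3 c b le_rfl) (key _ _ _ _ _ _ h1 h0 h2 (he 1) a c (ho 2) (by omega))
  · exact fin 0 (e3 le_rfl a c) (key _ _ _ _ _ _ h1 h2 h0 (he 1) b c (ho 0) (by omega))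
  · exact fin 0 (e3 le_rfl a (b.trans a))
      (key _ _ _ _ _ _ h2 h1 h0 (he 2) b a (ho 0) (by omega))
  · exact fin 0 (e3 le_rfl a c) (key _ _ _ _ _ _ h2 h1 h0 (he 2) b a (ho 0) (by omega))

/-- The numerical consequence of Burnside's orbit count: either some orbit has at most two
points, or the stabilisers have the orders of one of the polyhedral groups. -/
lemma orbit_numbers {I : Type*} [Fintype I] {n : ℕ} (hn : 2 ≤ n) {o e : I → ℕ}
    (hoe : ∀ i, o i * e i = n) (he : ∀ i, 2 ≤ e i)
    (hsum : ∑ i, o i + 2 * (n - 1) = Fintype.card I * n) :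
    (∃ i, o i ≤ 2) ∨
    ∃ m, (m = 3 ∧ n = 12 ∨ m = 4 ∧ n = 24 ∨ m = 5 ∧ n = 60) ∧ (∀ i, e i ≤ m) ∧ ∃ i, e i = m := by
  by_cases hsmall : ∃ i, o i ≤ 2
  · exact Or.inl hsmall
  right
  push Not at hsmall
  have hle : 2 * ∑ i, o i ≤ Fintype.card I * n := by
    rw [Finset.mul_sum, ← smul_eq_mul (Fintype.card I), ← Finset.card_univ]
    refine Finset.sum_le_card_nsmul _ _ _ fun i _ => ?_
    rw [← hoe i, mul_comm]
    exact Nat.mul_le_mul_left _ (he i)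
  have hc4 : Fintype.card I < 4 := by
    by_contra h
    have : 4 * n ≤ Fintype.card I * n := Nat.mul_le_mul_right _ (by omega)
    omega
  obtain ⟨c, hc⟩ : ∃ c, c = Fintype.card I := ⟨_, rfl⟩
  let ε : I ≃ Fin c := Fintype.equivFinOfCardEq hc.symm
  rw [← hc] at hc4 hsum
  rw [← ε.symm.sum_comp] at hsum
  interval_cases c
  · simp at hsum; omega
  · have := hsmall (ε.symm 0)
    simp at hsum; omega
  · have := hsmall (ε.symm 0)
    simp at hsum; omega
  · obtain ⟨m, hm, h1, i, h2⟩ := triangle_numbers (o := o ∘ ε.symm) (e := e ∘ ε.symm) (n := n)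
      (fun i => hoe _) (fun i => he _) (fun i => hsmall _)
      (by rw [Fin.sum_univ_three] at hsum; simp only [Function.comp]; omega)
    exact ⟨m, hm, fun i => by simpa using h1 (ε i), _, h2⟩

variable {H Ω : Type*} [Group H] [MulAction H Ω]

/-- The points with nontrivial stabiliser. -/
def specialPoints (H Ω : Type*) [Group H] [MulAction H Ω] : SubMulAction H Ω where
  carrier := {p | stabilizer H p ≠ ⊥}
  smul_mem' := by
    intro g p hp h
    refine hp ?_
    rw [stabilizer_smul_eq_stabilizer_map_conj] at h
    rwa [Subgroup.map_eq_bot_iff_of_injective _ (MulAut.conj g).injective] at h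

lemma mem_specialPoints {p : Ω} : p ∈ specialPoints H Ω ↔ ∃ h : H, h ≠ 1 ∧ h • p = p := by
  change stabilizer H p ≠ ⊥ ↔ _
  rw [Subgroup.ne_bot_iff_exists_ne_one]
  simp only [ne_eq, Subtype.exists, mem_stabilizer_iff, Subgroup.mk_eq_one]
  tauto

variable (hH : FixesTwoPoints H Ω)
include hH

lemma FixesTwoPoints.finite_fixedBy {h : H} (h1 : h ≠ 1) : (fixedBy Ω h).Finite :=
  Set.finite_of_ncard_ne_zero (by rw [hH h h1]; norm_num)

lemma FixesTwoPoints.fixedBy_eq_of_subset {g h : H} (hg : g ≠ 1) (hh : h ≠ 1)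
    (hs : fixedBy Ω g ⊆ fixedBy Ω h) : fixedBy Ω g = fixedBy Ω h :=
  Set.eq_of_subset_of_ncard_le hs (by rw [hH g hg, hH h hh]) (hH.finite_fixedBy hh)

/-- A nontrivial power of an element fixes the same two points as the element. -/
lemma FixesTwoPoints.fixedBy_zpow {h : H} {n : ℤ} (hn : h ^ n ≠ 1) :
    fixedBy Ω (h ^ n) = fixedBy Ω h := by
  refine (hH.fixedBy_eq_of_subset (fun h1 => hn (by simp [h1])) hn fun p hp => ?_).symm
  exact (stabilizer H p).zpow_mem hp n

lemma FixesTwoPoints.fixedBy_pow {h : H} {n : ℕ} (hn : h ^ n ≠ 1) :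
    fixedBy Ω (h ^ n) = fixedBy Ω h := by
  simpa using hH.fixedBy_zpow (h := h) (n := n) (by simpa using hn)

lemma FixesTwoPoints.finite_specialPoints [Finite H] : Finite (specialPoints H Ω) := by
  have : ((specialPoints H Ω : SubMulAction H Ω) : Set Ω) ⊆
      ⋃ h : {h : H // h ≠ 1}, fixedBy Ω h.1 := by
    intro p hp
    obtain ⟨h, h1, h2⟩ := mem_specialPoints.1 hp
    exact Set.mem_iUnion.2 ⟨⟨h, h1⟩, h2⟩
  exact ((Set.finite_iUnion fun h : {h : H // h ≠ 1} => hH.finite_fixedBy h.2).subset this)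

/-- The classification by orbit counting: a point with stabiliser of index at most two, or one of
the three polyhedral types, distinguished by the largest order of a stabiliser. -/
theorem FixesTwoPoints.dichotomy [Finite H] [Nonempty Ω] :
    (∃ p : Ω, (stabilizer H p).index ≤ 2) ∨
    ∃ m, (m = 3 ∧ Nat.card H = 12 ∨ m = 4 ∧ Nat.card H = 24 ∨ m = 5 ∧ Nat.card H = 60) ∧
      (∀ p : Ω, Nat.card (stabilizer H p) ≤ m) ∧ ∃ p : Ω, Nat.card (stabilizer H p) = m := by
  classical
  have := hH.finite_specialPoints
  cases nonempty_fintype H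
  let S := specialPoints H Ω
  cases nonempty_fintype S
  let Q := Quotient (orbitRel H S)
  have : Finite Q := Quotient.finite _
  cases nonempty_fintype Q
  have stab (p : S) : stabilizer H p = stabilizer H (p : Ω) := SubMulAction.stabilizer_of_subMul p
  rcases Nat.lt_or_ge (Nat.card H) 2 with hn | hn
  · obtain ⟨p⟩ := ‹Nonempty Ω›
    exact Or.inl ⟨p, (Nat.le_of_dvd Nat.card_pos (Subgroup.index_dvd_card _)).trans (by omega)⟩
  have hfix : ∀ h : H, h ≠ 1 → Fintype.card (fixedBy S h) = 2 := by
    intro h h1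
    rw [← hH h h1, ← Nat.card_eq_fintype_card, ← Nat.card_coe_set_eq]
    refine Nat.card_congr
      { toFun := fun p => ⟨p.1.1, congrArg Subtype.val p.2⟩
        invFun := fun p => ⟨⟨p.1, mem_specialPoints.2 ⟨h, h1, p.2⟩⟩, Subtype.ext p.2⟩
        left_inv := fun _ => rfl
        right_inv := fun _ => rfl }
  have hburn := sum_card_fixedBy_eq_card_orbits_mul_card_group H S
  rw [← Finset.add_sum_erase _ _ (Finset.mem_univ (1 : H)),
    Finset.sum_congr rfl (g := fun _ => 2)
      (fun h hh => hfix h (Finset.ne_of_mem_erase hh)), Finset.sum_const,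
    Finset.card_erase_of_mem (Finset.mem_univ _), Finset.card_univ] at hburn
  have hcl : Fintype.card (fixedBy S (1 : H)) =
      ∑ ω : Q, (stabilizer H (ω.out : S)).index := by
    have h1 : Nat.card (fixedBy S (1 : H)) = Nat.card S :=
      Nat.card_congr (Equiv.subtypeUnivEquiv fun p => one_smul _ p)
    rw [← Nat.card_eq_fintype_card, h1,
      Nat.card_congr (selfEquivSigmaOrbitsQuotientStabilizer H S), Nat.card_sigma]
    rfl
  rw [hcl, smul_eq_mul, mul_comm (_ - 1), ← Nat.card_eq_fintype_card (α := H)] at hburn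
  rcases orbit_numbers (I := Q) hn (o := fun ω => (stabilizer H (ω.out : S)).index)
      (e := fun ω => Nat.card (stabilizer H (ω.out : S)))
      (fun ω => Subgroup.index_mul_card _)
      (fun ω => by
        by_contra h
        have h1 : Nat.card (stabilizer H (ω.out : S)) = 1 := by
          have : 0 < Nat.card (stabilizer H (ω.out : S)) := Nat.card_pos
          omega
        rw [stab, Subgroup.card_eq_one] at h1
        exact (ω.out : S).2 h1) hburn with ⟨ω, hω⟩ | ⟨m, hm, h1, ω, h2⟩
  · left
    exact ⟨(ω.out : S), by rwa [← stab]⟩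
  · right
    refine ⟨m, hm, fun p => ?_, (ω.out : S), by rwa [← stab]⟩
    by_cases hp : p ∈ S
    · let ω' : Q := Quotient.mk'' ⟨p, hp⟩
      have hr : (orbitRel H S) (ω'.out) ⟨p, hp⟩ := Quotient.mk_out (s := orbitRel H S) _
      obtain ⟨g, hg⟩ := hr
      have := h1 ω'
      rw [← hg] at this
      refine le_trans (le_of_eq ?_) this
      rw [stabilizer_smul_eq_stabilizer_map_conj, stab]
      exact (Nat.card_congr ((stabilizer H p).equivMapOfInjective _
        (MulAut.conj g).injective).toEquiv)
    · have : stabilizer H p = ⊥ := by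
        by_contra h; exact hp h
      rw [this]
      simp only [Subgroup.card_bot]
      omega

lemma FixesTwoPoints.comap {H' : Type*} [Group H'] {f : H' →* H}
    (hf : Function.Injective f) : letI := MulAction.compHom Ω f; FixesTwoPoints H' Ω := by
  let _ := MulAction.compHom Ω f
  intro h h1
  exact hH (f h) (fun h2 => h1 (hf (by simpa using h2)))

/-- All nontrivial elements of a cyclic stabiliser fix the same two points. -/
lemma FixesTwoPoints.fixedBy_eq_of_mem_stabilizer {p : Ω} [IsCyclic (stabilizer H p)] {g h : H}
    (hg : g ∈ stabilizer H p) (hh : h ∈ stabilizer H p) (hg1 : g ≠ 1) (hh1 : h ≠ 1) :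
    fixedBy Ω g = fixedBy Ω h := by
  obtain ⟨d, hd⟩ := IsCyclic.exists_generator (α := stabilizer H p)
  obtain ⟨m, hm⟩ := hd ⟨g, hg⟩
  obtain ⟨n, hn⟩ := hd ⟨h, hh⟩
  have hm' : (d : H) ^ m = g := congrArg Subtype.val hm
  have hn' : (d : H) ^ n = h := congrArg Subtype.val hn
  rw [← hm', ← hn', hH.fixedBy_zpow (by rwa [hm']), hH.fixedBy_zpow (by rwa [hn'])]

/-- In the polyhedral case the centre is trivial: a central element would fix two points which
the whole group permutes. -/
theorem FixesTwoPoints.center_eq_bot (hno : ¬ ∃ p : Ω, (stabilizer H p).index ≤ 2) :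
    Subgroup.center H = ⊥ := by
  rw [Subgroup.eq_bot_iff_forall]
  intro z hz
  by_contra hz1
  obtain ⟨p, q, -, hpq⟩ := Set.ncard_eq_two.1 (hH z hz1)
  have hp : z • p = p := by
    change p ∈ fixedBy Ω z
    simp [hpq]
  refine hno ⟨p, ?_⟩
  rw [index_stabilizer]
  have : orbit H p ⊆ fixedBy Ω z := by
    rintro _ ⟨g, rfl⟩
    change z • g • p = g • p
    rw [smul_smul, ← Subgroup.mem_center_iff.1 hz g, mul_smul, hp]
  exact (Set.ncard_le_ncard this (hH.finite_fixedBy hz1)).trans (hH z hz1).le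

/-- In the polyhedral case the group is generated by two conjugate elements: a generator of a
largest stabiliser and a conjugate of it with different fixed points. -/
theorem FixesTwoPoints.two_generated [Finite H] (hc : ∀ p : Ω, IsCyclic (stabilizer H p))
    [Nonempty Ω] (hno : ¬ ∃ p : Ω, (stabilizer H p).index ≤ 2) :
    Nat.card H ≤ 60 ∧ ∃ a b : H, Subgroup.closure {a, b} = ⊤ := by
  rcases hH.dichotomy with h | ⟨m, hm, hle, p, hp⟩
  · exact absurd h hno
  refine ⟨by omega, ?_⟩
  have hm3 : 3 ≤ m := by omega
  obtain ⟨⟨a, hap⟩, ha⟩ := IsCyclic.exists_ofOrder_eq_natCard (α := stabilizer H p)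
  rw [hp, Subgroup.orderOf_mk] at ha
  have ha2 : a ^ 2 ≠ 1 := fun h => by
    have := Nat.le_of_dvd (by norm_num) (orderOf_dvd_of_pow_eq_one h)
    omega
  have ha1 : a ≠ 1 := fun h => ha2 (by simp [h])
  -- some conjugate of `a` has other fixed points, as the orbit of `p` has more than two points
  obtain ⟨c, hcp⟩ : ∃ c : H, c • p ∉ fixedBy Ω a := by
    by_contra! h
    have : orbit H p ⊆ fixedBy Ω a := by
      rintro _ ⟨g, rfl⟩; exact h g
    refine hno ⟨p, ?_⟩
    rw [index_stabilizer]
    exact (Set.ncard_le_ncard this (hH.finite_fixedBy ha1)).trans (hH a ha1).le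
  let b := c * a * c⁻¹
  have hb : b • c • p = c • p := by
    simp only [b, mul_smul, inv_smul_smul]
    rw [show a • p = p from hap]
  have hb2 : b ^ 2 ≠ 1 := by
    simp only [b, conj_pow]
    simpa using ha2
  have hb1 : b ≠ 1 := fun h => hb2 (by simp [h])
  refine ⟨a, b, ?_⟩
  let H₀ := Subgroup.closure {a, b}
  have haH : a ∈ H₀ := Subgroup.subset_closure (by simp)
  have hbH : b ∈ H₀ := Subgroup.subset_closure (by simp)
  have h₀ : FixesTwoPoints H₀ Ω := hH.comap (f := H₀.subtype) H₀.subtype_injective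
  have hsub (r : Ω) : stabilizer H₀ r = (stabilizer H r).subgroupOf H₀ := rfl
  have hcard (r : Ω) : Nat.card (stabilizer H₀ r) ≤ Nat.card (stabilizer H r) :=
    Nat.card_le_card_of_injective
      (fun x : stabilizer H₀ r => (⟨x.1.1, x.2⟩ : stabilizer H r))
      (fun x y h => Subtype.ext (Subtype.ext (congrArg (fun z => z.1) h)))
  have hpm : m ≤ Nat.card (stabilizer H₀ p) := by
    have hap₀ : (⟨a, haH⟩ : H₀) ∈ stabilizer H₀ p := hap
    rw [← ha, ← Subgroup.orderOf_mk a haH, ← Subgroup.orderOf_mk (⟨a, haH⟩ : H₀) hap₀]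
    exact orderOf_le_card
  rcases h₀.dichotomy with ⟨r, hr⟩ | ⟨m', hm', hle', p', hp'⟩
  · -- squares lie in a subgroup of index two, so `a` and `b` would share a fixed point
    exfalso
    have sq : ∀ x (hx : x ∈ H₀), x ^ 2 ∈ stabilizer H r := by
      intro x hx
      rcases Nat.lt_or_ge (stabilizer H₀ r).index 2 with h1 | h1
      · have h2 : (stabilizer H₀ r).index = 1 := by
          have := (stabilizer H₀ r).index_ne_zero_of_finite
          omega
        rw [Subgroup.index_eq_one] at h2
        have : (⟨x, hx⟩ : H₀) ∈ stabilizer H₀ r := by rw [h2]; trivial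
        exact (stabilizer H r).pow_mem this 2
      · exact Subgroup.sq_mem_of_index_two (H := stabilizer H₀ r) (le_antisymm hr h1) ⟨x, hx⟩
    have h1 := hH.fixedBy_eq_of_mem_stabilizer (sq a haH) (sq b hbH) ha2 hb2
    rw [hH.fixedBy_pow ha2, hH.fixedBy_pow hb2] at h1
    exact hcp (h1 ▸ hb)
  · have : m' = m := by
      have h1 := hle' p
      have h2 := (hcard p').trans (hle p')
      omega
    refine Subgroup.eq_top_of_card_eq _ ?_
    change Nat.card H₀ = _
    omega

end FixesTwo

section FixesTwoDihedral

open MulAction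

variable {H Ω : Type*} [Group H] [MulAction H Ω] (hH : FixesTwoPoints H Ω)
include hH

/-- In the cyclic or dihedral case, an element of order at least three fixing `p` commutes only
with elements fixing `p`: an element exchanging the two fixed points would invert it. -/
theorem FixesTwoPoints.mem_stabilizer_of_commute {p : Ω} {a x : H} (ha : a ∈ stabilizer H p)
    (ha2 : a ^ 2 ≠ 1) (hx : x * a = a * x) : x ∈ stabilizer H p := by
  by_contra hxp
  have ha1 : a ≠ 1 := fun h => ha2 (by simp [h])
  have hinv : ∀ r ∈ fixedBy Ω a, x • r ∈ fixedBy Ω a := by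
    intro r hr
    change a • x • r = x • r
    rw [smul_smul, ← hx, mul_smul, show a • r = r from hr]
  have hpa : p ∈ fixedBy Ω a := ha
  have hxxp : x • x • p = p := by
    obtain ⟨q, r, hqr, hs⟩ := Set.ncard_eq_two.1 (hH a ha1)
    have h1 := hinv p hpa
    have h2 := hinv _ h1
    have h3 : x • p ≠ p := hxp
    have h4 : x • x • p ≠ x • p := fun h => h3 (smul_left_cancel x h)
    rw [hs] at hpa h1 h2
    simp only [Set.mem_insert_iff, Set.mem_singleton_iff] at hpa h1 h2
    rcases hpa with h | h <;> rcases h1 with h' | h' <;> rcases h2 with h'' | h'' <;>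
      simp_all
  -- an element exchanging `p` with the other point has order two
  have sq : ∀ y : H, y • p ≠ p → y • y • p = p → y ^ 2 = 1 := by
    intro y hy hyy
    by_contra h
    have : p ∈ fixedBy Ω (y ^ 2) := by
      change (y ^ 2) • p = p
      rw [sq, mul_smul, hyy]
    rw [hH.fixedBy_pow h] at this
    exact hy this
  have hap : a • p = p := ha
  have h1 := sq x hxp hxxp
  have h2 := sq (x * a) (by rwa [mul_smul, hap]) (by
    rw [mul_smul, mul_smul, hap, smul_smul a, ← hx, mul_smul, hap, hxxp])
  apply ha2
  rw [(show Commute x a from hx).mul_pow, h1, one_mul] at h2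
  exact h2

/-- A point stabiliser of index at most two contains the images of its elements of order at least
three under all automorphisms, since it contains their squares, which have the same fixed points. -/
theorem FixesTwoPoints.stabilizer_invariant {p : Ω} (hidx : (stabilizer H p).index ≤ 2)
    [Finite H] {a : H} (ha2 : a ^ 2 ≠ 1) (φ : H ≃* H) :
    φ a ∈ stabilizer H p := by
  have hd2 : φ a ^ 2 ≠ 1 := by
    rw [← map_pow]
    exact fun h => ha2 (φ.injective (h.trans (map_one φ).symm))
  have hmem : φ a ^ 2 ∈ stabilizer H p := by
    have h0 := (stabilizer H p).index_ne_zero_of_finite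
    rcases (by omega : (stabilizer H p).index = 1 ∨ (stabilizer H p).index = 2) with h | h
    · rw [Subgroup.index_eq_one] at h
      rw [h]; trivial
    · exact Subgroup.sq_mem_of_index_two h _
  have : p ∈ fixedBy Ω (φ a ^ 2) := hmem
  rwa [hH.fixedBy_pow hd2] at this

end FixesTwoDihedral

/-! ### Abelian normal subgroups of group extensions -/

section Extensions

open Subgroup

variable {G : Type*} [Group G]

/-- If all conjugates of `x` under `K` lie in a finite set `S`, the centraliser of `x` has index
at most `S.ncard` in `K`. -/
lemma relIndex_centralizer_singleton_le (K : Subgroup G) (x : G) {S : Set G} (hS : S.Finite)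
    (h : ∀ g ∈ K, g * x * g⁻¹ ∈ S) : (centralizer {x}).relIndex K ≤ S.ncard := by
  have := hS.to_subtype
  rw [relIndex, index, ← Nat.card_coe_set_eq]
  refine Nat.card_le_card_of_injective
    (fun c : K ⧸ (centralizer {x}).subgroupOf K =>
      (⟨c.out * x * (c.out : G)⁻¹, h _ c.out.2⟩ : S)) fun c d hcd => ?_
  have h1 : (c.out : G) * x * (c.out : G)⁻¹ = d.out * x * (d.out : G)⁻¹ := congrArg Subtype.val hcd
  rw [← c.out_eq', ← d.out_eq']
  refine QuotientGroup.eq.2 ?_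
  rw [mem_subgroupOf, mem_centralizer_singleton_iff]
  simp only [coe_mul, coe_inv]
  have h2 : x * ((c.out : G)⁻¹ * d.out) = (c.out : G)⁻¹ * (c.out * x * (c.out : G)⁻¹) * d.out := by
    group
  rw [h2, h1]
  group

lemma index_centralizer_singleton_le (N : Subgroup G) [N.Normal] [Finite N] {x : G} (hx : x ∈ N) :
    (centralizer {x}).index ≤ Nat.card N := by
  rw [← relIndex_top_right]
  exact (relIndex_centralizer_singleton_le ⊤ x (S := N) (Set.toFinite _)
    fun g _ => Normal.conj_mem ‹_› x hx g).trans (Nat.card_coe_set_eq _).ge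

lemma index_centralizer_le_pow (N : Subgroup G) [N.Normal] [Finite N] :
    (centralizer (N : Set G)).index ≤ Nat.card N ^ Nat.card N := by
  cases nonempty_fintype N
  have : centralizer (N : Set G) = ⨅ x : N, centralizer {(x : G)} := by
    ext g
    simp only [mem_centralizer_iff, mem_iInf, SetLike.mem_coe, Set.mem_singleton_iff, forall_eq,
      Subtype.forall]
  rw [this]
  refine (index_iInf_le _).trans ?_
  refine (Finset.prod_le_pow_card _ _ _ fun x _ => index_centralizer_singleton_le N x.2).trans ?_
  rw [Finset.card_univ, Nat.card_eq_fintype_card]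

lemma mul_mem_of_relIndex_le_two {N M : Subgroup G} (h0 : N.relIndex M ≠ 0)
    (hrel : N.relIndex M ≤ 2) {u v : G} (hu : u ∈ M) (hv : v ∈ M) (hu' : u ∉ N) (hv' : v ∉ N) :
    u * v ∈ N := by
  rcases (by omega : N.relIndex M = 1 ∨ N.relIndex M = 2) with h | h
  · exact absurd (relIndex_eq_one.1 h hu) hu'
  · have := mul_mem_iff_of_index_two h (a := ⟨u, hu⟩) (b := ⟨v, hv⟩)
    simp only [mem_subgroupOf, coe_mul] at this
    tauto

/-- `M / N` has order at most two, so it is central in `G / N`. -/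
lemma conj_mul_inv_mem_of_relIndex_le_two {N M : Subgroup G} [N.Normal] [hM : M.Normal]
    (h0 : N.relIndex M ≠ 0) (hrel : N.relIndex M ≤ 2) {u : G} (hu : u ∈ M) (g : G) :
    g * u * g⁻¹ * u⁻¹ ∈ N := by
  by_cases hu' : u ∈ N
  · exact N.mul_mem (Normal.conj_mem ‹_› u hu' g) (N.inv_mem hu')
  · refine mul_mem_of_relIndex_le_two h0 hrel (hM.conj_mem u hu g) (M.inv_mem hu) ?_ ?_
    · intro h
      apply hu'
      have := Normal.conj_mem ‹N.Normal› _ h g⁻¹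
      simpa [mul_assoc] using this
    · simpa using hu'

/-- If `P / M` is cyclic and `M / N` has order at most two, then `P / N` is abelian. -/
lemma commutator_mem_of_cyclic {N M P : Subgroup G} [N.Normal] [M.Normal]
    (h0 : N.relIndex M ≠ 0) (hrel : N.relIndex M ≤ 2) {Z : Type*} [Group Z] [IsCyclic Z]
    (f : P →* Z) (hf : ∀ x : P, f x = 1 → (x : G) ∈ M) (hNf : ∀ x : P, (x : G) ∈ N → f x = 1)
    {x y : G} (hx : x ∈ P) (hy : y ∈ P) : x * y * x⁻¹ * y⁻¹ ∈ N := by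
  let f' : P ⧸ N.subgroupOf P →* Z := QuotientGroup.lift _ f fun z hz => hNf z hz
  have hc : IsMulCommutative (P ⧸ N.subgroupOf P) := by
    refine f'.isMulCommutative_of_isCyclic_of_ker_le_center fun z hz => ?_
    obtain ⟨z, rfl⟩ := QuotientGroup.mk_surjective z
    rw [mem_center_iff]
    intro g
    obtain ⟨g, rfl⟩ := QuotientGroup.mk_surjective g
    have := conj_mul_inv_mem_of_relIndex_le_two h0 hrel (hf z hz) g
    rw [← QuotientGroup.mk_mul, ← QuotientGroup.mk_mul, eq_comm, QuotientGroup.eq, mem_subgroupOf]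
    have h2 := Normal.conj_mem ‹N.Normal› _ this ((z : G) * g)⁻¹
    simpa [mul_assoc] using h2
  have := hc.is_comm.comm (QuotientGroup.mk (⟨y, hy⟩⁻¹ : P)) (QuotientGroup.mk (⟨x, hx⟩⁻¹ : P))
  rw [← QuotientGroup.mk_mul, ← QuotientGroup.mk_mul, QuotientGroup.eq, mem_subgroupOf] at this
  simpa [mul_assoc] using this

lemma normal_of_index_le_two {P : Subgroup G} (h0 : P.index ≠ 0) (hP : P.index ≤ 2) :
    P.Normal := by
  rcases (by omega : P.index = 1 ∨ P.index = 2) with h | h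
  · rw [index_eq_one] at h
    subst h; infer_instance
  · exact normal_of_index_eq_two h

/-- If `N` has trivial centre, then `P ∩ C_G(N)` is abelian as soon as `P / N` is. -/
lemma isMulCommutative_inf_centralizer {N P : Subgroup G}
    (hcomm : ∀ x ∈ P, ∀ y ∈ P, x * y * x⁻¹ * y⁻¹ ∈ N) (hN : center N = ⊥) :
    IsMulCommutative (P ⊓ centralizer (N : Set G) : Subgroup G) := by
  refine isMulCommutative_iff.2 ?_
  rintro ⟨x, hx⟩ ⟨y, hy⟩
  have hz := hcomm x hx.1 y hy.1
  set z := x * y * x⁻¹ * y⁻¹ with hzdef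
  have hzc : z ∈ centralizer (N : Set G) :=
    mul_mem (mul_mem (mul_mem hx.2 hy.2) (inv_mem hx.2)) (inv_mem hy.2)
  have : (⟨z, hz⟩ : N) ∈ center N := by
    rw [mem_center_iff]
    intro g
    exact Subtype.ext (hzc g g.2)
  rw [hN, mem_bot] at this
  have h1 : z = 1 := congrArg Subtype.val this
  refine Subtype.ext ?_
  change x * y = y * x
  rw [hzdef, mul_inv_eq_one, mul_inv_eq_iff_eq_mul] at h1
  exact h1

/-- An extension of a cyclic group by an abelian normal subgroup `E` that is self-centralising in
`N`, up to the subquotient `M / N` of order at most two: centralising `E` and then one more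
element `z` of `M` costs at most the number of `e ∈ E` with `e² = 1`. -/
theorem exists_abelian_of_self_centralizing [Finite G] {N M P E : Subgroup G} [N.Normal]
    [M.Normal] [E.Normal] (hNM : N ≤ M) (hrel : N.relIndex M ≤ 2) (hP : P.index ≤ 2)
    {Z : Type*} [Group Z] [IsCyclic Z] (f : P →* Z) (hf : ∀ x : P, f x = 1 → (x : G) ∈ M)
    (hEN : E ≤ N) (hE : ∀ x ∈ N, x ∈ centralizer (E : Set G) ↔ x ∈ E)
    {m r : ℕ} (hm : (centralizer (E : Set G)).index ≤ m)
    (hr : {e : G | e ∈ E ∧ e ^ 2 = 1}.ncard ≤ r) (hr1 : 1 ≤ r) :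
    ∃ A : Subgroup G, A.Normal ∧ IsMulCommutative A ∧ A.index ≤ 2 * (r * m) := by
  have h0 : N.relIndex M ≠ 0 := index_ne_zero_of_finite
  have hPn : P.Normal := normal_of_index_le_two index_ne_zero_of_finite hP
  let W := centralizer (E : Set G) ⊓ M
  have hEW : E ≤ W := le_inf (fun x hx => (hE x (hEN hx)).2 hx) (hEN.trans hNM)
  have hWN : ∀ x ∈ W, x ∈ N → x ∈ E := fun x hx hxN => (hE x hxN).1 hx.1
  have hWE : ∀ x ∈ W, ∀ e ∈ E, x * e = e * x := fun x hx e he => (hx.1 e he).symm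
  have hWcomm : ∀ x ∈ W, ∀ y ∈ W, x * y = y * x := by
    intro x hx y hy
    by_cases hxN : x ∈ N
    · exact (hWE y hy x (hWN x hx hxN)).symm
    by_cases hyN : y ∈ N
    · exact hWE x hx y (hWN y hy hyN)
    have h1 : x * y ∈ E :=
      hWN _ (mul_mem hx hy) (mul_mem_of_relIndex_le_two h0 hrel hx.2 hy.2 hxN hyN)
    have h2 := hWE x hx _ h1
    rw [mul_assoc] at h2
    exact mul_left_cancel h2
  let A := P ⊓ centralizer (W : Set G)
  refine ⟨A, inferInstance, ?_, ?_⟩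
  · let fA : A →* Z := f.comp (inclusion inf_le_left)
    refine fA.isMulCommutative_of_isCyclic_of_ker_le_center fun z hz => ?_
    have hzM : (z : G) ∈ M := hf _ hz
    have hzW : (z : G) ∈ W := ⟨centralizer_le hEW z.2.2, hzM⟩
    rw [mem_center_iff]
    exact fun g => Subtype.ext (g.2.2 z hzW).symm
  · refine index_inf_le.trans (Nat.mul_le_mul hP ?_)
    by_cases hz : ∃ z ∈ W, z ∉ N
    · obtain ⟨z, hzW, hzN⟩ := hz
      have hzz : z ^ 2 ∈ E := by
        rw [sq]
        exact hWN _ (mul_mem hzW hzW)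
          (mul_mem_of_relIndex_le_two h0 hrel hzW.2 hzW.2 hzN hzN)
      have hcW : centralizer (E : Set G) ⊓ centralizer {z} ≤ centralizer (W : Set G) := by
        rintro g ⟨hgE, hgz⟩ w hw
        replace hgz := mem_centralizer_singleton_iff.1 hgz
        by_cases hwN : w ∈ N
        · exact hgE w (hWN w hw hwN)
        · have h1 : z * w ∈ E :=
            hWN _ (mul_mem hzW hw) (mul_mem_of_relIndex_le_two h0 hrel hzW.2 hw.2 hzN hwN)
          have h2 := hgE _ h1
          rw [← mul_assoc, hgz, mul_assoc, mul_assoc] at h2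
          exact mul_left_cancel h2
      refine (Nat.le_of_dvd (Nat.pos_of_ne_zero index_ne_zero_of_finite)
        (index_dvd_of_le hcW)).trans ?_
      rw [← relIndex_mul_index (inf_le_left : centralizer (E : Set G) ⊓ centralizer {z} ≤ _),
        inf_relIndex_left]
      refine Nat.mul_le_mul ?_ hm
      refine (relIndex_centralizer_singleton_le _ z
        (S := (z * ·) '' {e : G | e ∈ E ∧ e ^ 2 = 1}) (Set.toFinite _) fun g hg => ?_).trans
          ((Set.ncard_image_le (Set.toFinite _)).trans hr)
      have hWn : W.Normal := inferInstance
      have hgzW : g * z * g⁻¹ ∈ W := hWn.conj_mem z hzW g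
      have he : z⁻¹ * (g * z * g⁻¹) ∈ E := by
        refine hWN _ (mul_mem (inv_mem hzW) hgzW) ?_
        have := conj_mul_inv_mem_of_relIndex_le_two h0 hrel hzW.2 g
        have h2 := Normal.conj_mem ‹N.Normal› _ this z⁻¹
        simpa [mul_assoc] using h2
      refine ⟨z⁻¹ * (g * z * g⁻¹), ⟨he, ?_⟩, by simp⟩
      have hc : Commute z⁻¹ (g * z * g⁻¹) := hWcomm _ (inv_mem hzW) _ hgzW
      rw [hc.mul_pow, conj_pow, ← hg _ hzz, mul_inv_cancel_right, inv_pow, inv_mul_cancel]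
    · push Not at hz
      have : centralizer (E : Set G) ≤ centralizer (W : Set G) :=
        centralizer_le fun w hw => hWN w hw (hz w hw)
      refine (Nat.le_of_dvd (Nat.pos_of_ne_zero index_ne_zero_of_finite)
        (index_dvd_of_le this)).trans (hm.trans ?_)
      exact Nat.le_mul_of_pos_left m hr1

/-- A group of order at most four is abelian. -/
lemma isMulCommutative_of_card_le_four {N : Type*} [Group N] [Finite N] (h : Nat.card N ≤ 4) :
    IsMulCommutative N := by
  have h0 : 0 < Nat.card N := Nat.card_pos
  have cyc : IsCyclic N → IsMulCommutative N := fun _ => inferInstance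
  rcases (by omega : Nat.card N = 1 ∨ Nat.card N = 2 ∨ Nat.card N = 3 ∨ Nat.card N = 4) with
    h | h | h | h
  · have := (Nat.card_eq_one_iff_unique.1 h).1
    exact cyc inferInstance
  · have := Fact.mk Nat.prime_two
    exact cyc (isCyclic_of_prime_card h)
  · have := Fact.mk Nat.prime_three
    exact cyc (isCyclic_of_prime_card h)
  · have := Fact.mk Nat.prime_two
    exact IsPGroup.isMulCommutative_of_card_eq_prime_sq (p := 2) (by simpa using h)

/-- The possible shapes of the normal subgroup `N` of `G` acting on the fibres: polyhedral, of
order at most four, or cyclic or dihedral with rotation subgroup generated by `c`, each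
element of which is centralised or inverted by each element of `G`. -/
inductive FibreType (N : Subgroup G) : Prop
  | polyhedral (hcard : Nat.card N ≤ 60) (hcenter : center N = ⊥) (a b : N)
      (hgen : closure {a, b} = ⊤)
  | small (hcard : Nat.card N ≤ 4)
  | dihedral (c : G) (hc : c ∈ N) (hidx : (zpowers c).relIndex N ≤ 2)
      (hself : ∀ x ∈ N, x * c = c * x → x ∈ zpowers c)
      (hconj : ∀ g : G, g * c * g⁻¹ = c ∨ g * c * g⁻¹ = c⁻¹)

lemma zpowers_normal_of_conj {c : G} (hconj : ∀ g : G, g * c * g⁻¹ = c ∨ g * c * g⁻¹ = c⁻¹) :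
    (zpowers c).Normal := by
  refine ⟨?_⟩
  rintro _ ⟨n, rfl⟩ g
  have : g * c ^ n * g⁻¹ = (g * c * g⁻¹) ^ n := conj_zpow.symm
  change g * c ^ n * g⁻¹ ∈ _
  rw [this]
  refine zpow_mem ?_ n
  rcases hconj g with h | h <;> rw [h]
  · exact mem_zpowers c
  · exact inv_mem (mem_zpowers c)

/-- If the group `G / M` acting on the base has order at most `60`, then `N` has index at most
`120`, and the subgroup `1`, `N` or `⟨c⟩` will do, according to the type of `N`. -/
theorem exists_abelian_index_le_of_small_base [Finite G] {N M : Subgroup G} [N.Normal] [M.Normal]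
    (hNM : N ≤ M) (hrel : N.relIndex M ≤ 2) (hN : FibreType N) (hM : M.index ≤ 60) :
    ∃ A : Subgroup G, A.Normal ∧ IsMulCommutative A ∧ A.index ≤ 7200 := by
  have hNi : N.index ≤ 120 := by
    rw [← relIndex_mul_index hNM]
    exact Nat.mul_le_mul hrel hM
  rcases hN with ⟨hcard, -, -, -, -⟩ | hcard | ⟨c, hc, hidx, -, hconj⟩
  · refine ⟨⊥, inferInstance, inferInstance, ?_⟩
    rw [index_bot, ← N.card_mul_index]
    exact Nat.mul_le_mul hcard hNi
  · exact ⟨N, inferInstance, isMulCommutative_of_card_le_four hcard, by omega⟩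
  · refine ⟨zpowers c, zpowers_normal_of_conj hconj, inferInstance, ?_⟩
    rw [← relIndex_mul_index (zpowers_le.2 hc)]
    exact (Nat.mul_le_mul hidx hNi).trans (by norm_num)

/-- If a subgroup `P / M` of index at most two in `G / M` is cyclic, then the subgroup is
`P ∩ C_G(N)` for polyhedral `N`, and otherwise comes from
`exists_abelian_of_self_centralizing` for `E = N` or `E = ⟨c⟩`. -/
theorem exists_abelian_index_le_of_cyclic_base [Finite G] {N M P : Subgroup G} [N.Normal]
    [M.Normal] (hNM : N ≤ M) (hrel : N.relIndex M ≤ 2) (hN : FibreType N) (hP : P.index ≤ 2)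
    {Z : Type*} [Group Z] [IsCyclic Z] (f : P →* Z) (hf : ∀ x : P, f x = 1 ↔ (x : G) ∈ M) :
    ∃ A : Subgroup G, A.Normal ∧ IsMulCommutative A ∧ A.index ≤ 7200 := by
  have h0 : N.relIndex M ≠ 0 := index_ne_zero_of_finite
  have hPn : P.Normal := normal_of_index_le_two index_ne_zero_of_finite hP
  rcases hN with ⟨hcard, hcenter, a, b, hgen⟩ | hcard | ⟨c, hc, hidx, hself, hconj⟩
  · refine ⟨P ⊓ centralizer (N : Set G), inferInstance,
      isMulCommutative_inf_centralizer (fun x hx y hy => commutator_mem_of_cyclic h0 hrel f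
        (fun x => (hf x).1) (fun x hxN => (hf x).2 (hNM hxN)) hx hy) hcenter, ?_⟩
    have hN2 : centralizer {(a : G)} ⊓ centralizer {(b : G)} ≤ centralizer (N : Set G) := by
      have h1 : (closure {a, b}).map N.subtype = N := by
        rw [hgen, ← MonoidHom.range_eq_map, N.range_subtype]
      rw [MonoidHom.map_closure, Set.image_pair] at h1
      have h3 : centralizer (N : Set G) = centralizer {(a : G), (b : G)} :=
        (congrArg (fun K : Subgroup G => centralizer (K : Set G)) h1.symm).trans
          (centralizer_closure _)
      rw [h3, centralizer_eq_iInf {(a : G), (b : G)}, iInf_pair]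
    have h2 : (centralizer (N : Set G)).index ≤ 60 * 60 := by
      refine (Nat.le_of_dvd (Nat.pos_of_ne_zero index_ne_zero_of_finite)
        (index_dvd_of_le hN2)).trans (index_inf_le.trans ?_)
      exact Nat.mul_le_mul ((index_centralizer_singleton_le N a.2).trans hcard)
        ((index_centralizer_singleton_le N b.2).trans hcard)
    exact index_inf_le.trans ((Nat.mul_le_mul hP h2).trans (by norm_num))
  · have hcomm := isMulCommutative_of_card_le_four hcard
    obtain ⟨A, h1, h2, h3⟩ := exists_abelian_of_self_centralizing hNM hrel hP f
      (fun x => (hf x).1) (le_refl N)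
      (fun x hx => ⟨fun _ => hx, fun _ y hy =>
        congrArg Subtype.val (hcomm.is_comm.comm ⟨y, hy⟩ ⟨x, hx⟩)⟩)
      (m := 4 ^ 4) (r := 4)
      ((index_centralizer_le_pow N).trans
        ((Nat.pow_le_pow_left hcard _).trans (Nat.pow_le_pow_right (by norm_num) hcard)))
      ((Set.ncard_le_ncard (t := N) (fun e he => he.1) (Set.toFinite _)).trans
        ((Nat.card_coe_set_eq _).symm.le.trans hcard)) (by norm_num)
    exact ⟨A, h1, h2, h3.trans (by norm_num)⟩
  · have := zpowers_normal_of_conj hconj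
    have hcz : centralizer (zpowers c : Set G) = centralizer {c} := by
      rw [zpowers_eq_closure, centralizer_closure]
    obtain ⟨A, h1, h2, h3⟩ := exists_abelian_of_self_centralizing hNM hrel hP f
      (fun x => (hf x).1) (zpowers_le.2 hc)
      (fun x hx => by
        rw [hcz, mem_centralizer_singleton_iff]
        refine ⟨fun h => hself x hx h, ?_⟩
        rintro ⟨n, rfl⟩
        exact (Commute.refl c).zpow_left n)
      (m := 2) (r := 2)
      (by
        rw [hcz, ← relIndex_top_right]
        refine (relIndex_centralizer_singleton_le ⊤ c (S := {c, c⁻¹}) (Set.toFinite _)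
          fun g _ => hconj g).trans ((Set.ncard_insert_le _ _).trans (by simp)))
      (by
        classical
        cases nonempty_fintype (zpowers c)
        have h := IsCyclic.card_pow_eq_one_le (α := zpowers c) (n := 2) (by norm_num)
        rw [← Set.ncard_coe_finset] at h
        refine (Set.ncard_le_ncard ?_ (Set.toFinite _)).trans
          ((Set.ncard_image_le (f := Subtype.val) (Set.toFinite _)).trans h)
        intro e he
        have he2 : (⟨e, he.1⟩ : zpowers c) ^ 2 = 1 := Subtype.ext he.2
        exact ⟨⟨e, he.1⟩, by simpa using he2, rfl⟩) (by norm_num)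
    exact ⟨A, h1, h2, h3.trans (by norm_num)⟩

end Extensions

/-! ### Finite subgroups of `PGL₂` over an algebraically closed field -/

section PGL

open Matrix MulAction
open scoped LinearAlgebra.Projectivization MatrixGroups

variable {K : Type*} [Field K]

lemma det_sub_scalar_fin_two (M : Matrix (Fin 2) (Fin 2) K) (c : K) :
    (M - scalar (Fin 2) c).det = c ^ 2 - M.trace * c + M.det := by
  simp only [det_fin_two, trace_fin_two, Matrix.sub_apply, scalar_apply]
  simp
  ring

/-- A nonscalar matrix some positive power of which is scalar has two distinct eigenvalues, since
a matrix with a double eigenvalue is a scalar times a unipotent matrix, which has infinite order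
in characteristic zero. -/
lemma exists_eigenbasis [IsAlgClosed K] [CharZero K] {M : GL (Fin 2) K} {n : ℕ} (hn : n ≠ 0)
    (hMn : (M ^ n).val ∈ Set.range (scalar (Fin 2))) (hM : M.val ∉ Set.range (scalar (Fin 2))) :
    ∃ (a b : K) (v w : Fin 2 → K), a ≠ b ∧ a ≠ 0 ∧ b ≠ 0 ∧ v ≠ 0 ∧ w ≠ 0 ∧
      M.val *ᵥ v = a • v ∧ M.val *ᵥ w = b • w ∧ M.val.trace = a + b ∧ M.val.det = a * b := by
  have hd : M.val.discr ≠ 0 := fun h => (GeneralLinearGroup.IsParabolic.pow ⟨hM, h⟩ hn).1 hMn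
  obtain ⟨s, hs⟩ := IsAlgClosed.exists_eq_mul_self M.val.discr
  rw [discr_fin_two] at hs hd
  have hs0 : s ≠ 0 := by rintro rfl; simp [hs] at hd
  have h2 : (2 : K) ≠ 0 := two_ne_zero
  obtain ⟨a, ha⟩ : ∃ a, a = (M.val.trace + s) / 2 := ⟨_, rfl⟩
  obtain ⟨b, hb⟩ : ∃ b, b = (M.val.trace - s) / 2 := ⟨_, rfl⟩
  have htr : M.val.trace = a + b := by rw [ha, hb]; field_simp; ring
  have hdet : M.val.det = a * b := by
    rw [ha, hb]; field_simp; linear_combination -hs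
  have hdet0 : M.val.det ≠ 0 := M.det_ne_zero
  have eig : ∀ c, c * c - M.val.trace * c + M.val.det = 0 →
      ∃ v : Fin 2 → K, v ≠ 0 ∧ M.val *ᵥ v = c • v := by
    intro c hc
    have : (M.val - scalar (Fin 2) c).det = 0 := by
      rw [det_sub_scalar_fin_two, ← hc, sq]
    obtain ⟨v, hv, hv'⟩ := exists_mulVec_eq_zero_iff.2 this
    refine ⟨v, hv, ?_⟩
    rw [sub_mulVec, sub_eq_zero] at hv'
    rw [hv']
    ext i
    simp [scalar_apply, mulVec_diagonal]
  obtain ⟨v, hv, hv'⟩ := eig a (by rw [htr, hdet]; ring)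
  obtain ⟨w, hw, hw'⟩ := eig b (by rw [htr, hdet]; ring)
  refine ⟨a, b, v, w, fun h => hs0 ?_, ?_, ?_, hv, hw, hv', hw', htr, hdet⟩
  · have : a - b = s := by rw [ha, hb]; field_simp; ring
    rw [← this, h, sub_self]
  · rintro rfl; simp [hdet] at hdet0
  · rintro rfl; simp [hdet] at hdet0

/-- An eigenvector of a `2 × 2` matrix with distinct eigenvalues is proportional to one of the
two given ones. -/
lemma eigenvector_cases {M : Matrix (Fin 2) (Fin 2) K} {a b c : K} {u v w : Fin 2 → K}
    (hab : a ≠ b) (hv : v ≠ 0) (hw : w ≠ 0) (hMv : M *ᵥ v = a • v) (hMw : M *ᵥ w = b • w)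
    (hu : u ≠ 0) (hMu : M *ᵥ u = c • u) :
    (c = a ∧ ∃ r : K, r • v = u) ∨ (c = b ∧ ∃ r : K, r • w = u) := by
  have hli : LinearIndependent K ![v, w] := by
    rw [LinearIndependent.pair_iff]
    intro s t hst
    have h1 : M *ᵥ (s • v + t • w) = 0 := by rw [hst, mulVec_zero]
    rw [mulVec_add, mulVec_smul, mulVec_smul, hMv, hMw] at h1
    have h2 : (s * (a - b)) • v = 0 := by
      have : (s * (a - b)) • v = s • a • v + t • b • w - b • (s • v + t • w) := by module
      rw [this, h1, hst, smul_zero, sub_zero]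
    have hs : s = 0 := by
      rcases smul_eq_zero.1 h2 with h | h
      · exact (mul_eq_zero.1 h).resolve_right (sub_ne_zero.2 hab)
      · exact absurd h hv
    rw [hs, zero_smul, zero_add] at hst
    exact ⟨hs, (smul_eq_zero.1 hst).resolve_right hw⟩
  have hspan : Submodule.span K (Set.range ![v, w]) = ⊤ :=
    hli.span_eq_top_of_card_eq_finrank (by simp)
  have : u ∈ Submodule.span K {v, w} := by
    have h : u ∈ Submodule.span K (Set.range ![v, w]) := hspan ▸ Submodule.mem_top
    simpa [Matrix.range_cons, Set.pair_comm] using h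
  obtain ⟨r, s, rfl⟩ := Submodule.mem_span_pair.1 this
  rw [mulVec_add, mulVec_smul, mulVec_smul, hMv, hMw] at hMu
  have h0 : (r * (a - c)) • v + (s * (b - c)) • w = 0 := by
    have : (r * (a - c)) • v + (s * (b - c)) • w =
      r • a • v + s • b • w - c • (r • v + s • w) := by module
    rw [this, hMu, sub_self]
  obtain ⟨h1, h2⟩ := LinearIndependent.pair_iff.1 hli _ _ h0
  rcases mul_eq_zero.1 h1 with hr | hr
  · rcases mul_eq_zero.1 h2 with hs | hs
    · simp [hr, hs] at hu
    · exact Or.inr ⟨(sub_eq_zero.1 hs).symm, s, by simp [hr]⟩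
  · rcases mul_eq_zero.1 h2 with hs | hs
    · exact Or.inl ⟨(sub_eq_zero.1 hr).symm, r, by simp [hs]⟩
    · exact absurd ((sub_eq_zero.1 hr).trans (sub_eq_zero.1 hs).symm) hab

lemma PGL_mk_pow_eq_one {M : GL (Fin 2) K} {n : ℕ} :
    (ProjGenLinGroup.mk M : PGL(2, K)) ^ n = 1 ↔ (M ^ n).val ∈ Set.range (scalar (Fin 2)) := by
  rw [← map_pow, ProjGenLinGroup.mk_eq_one, GeneralLinearGroup.mem_center_iff_val_mem_range_scalar]

lemma PGL_mk_eq_one {M : GL (Fin 2) K} :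
    (ProjGenLinGroup.mk M : PGL(2, K)) = 1 ↔ M.val ∈ Set.range (scalar (Fin 2)) := by
  simpa using PGL_mk_pow_eq_one (M := M) (n := 1)

lemma PGL_smul_mk_eq_iff {M : GL (Fin 2) K} {v : Fin 2 → K} (hv : v ≠ 0) :
    (ProjGenLinGroup.mk M : PGL(2, K)) • (Projectivization.mk K v hv) = Projectivization.mk K v hv ↔
      ∃ a : K, M.val *ᵥ v = a • v := by
  rw [Projectivization.PGL.mk_smul_mk, Projectivization.mk_eq_mk_iff']
  exact ⟨fun ⟨a, h⟩ => ⟨a, h.symm⟩, fun ⟨a, h⟩ => ⟨a, h.symm⟩⟩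

/-- A nontrivial element of finite order in `PGL₂` fixes exactly two points of the projective
line. -/
theorem PGL_ncard_fixedBy [IsAlgClosed K] [CharZero K] {g : PGL(2, K)} (hg : IsOfFinOrder g)
    (h1 : g ≠ 1) : (fixedBy (ℙ K (Fin 2 → K)) g).ncard = 2 := by
  obtain ⟨M, rfl⟩ := ProjGenLinGroup.mk_surjective g
  obtain ⟨n, hn, hMn⟩ := isOfFinOrder_iff_pow_eq_one.1 hg
  obtain ⟨a, b, v, w, hab, -, -, hv, hw, hMv, hMw, -, -⟩ :=
    exists_eigenbasis hn.ne' (PGL_mk_pow_eq_one.1 hMn) (fun h => h1 (PGL_mk_eq_one.2 h))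
  have hne : Projectivization.mk K v hv ≠ Projectivization.mk K w hw := by
    intro h
    obtain ⟨r, hr⟩ := (Projectivization.mk_eq_mk_iff' K _ _ hv hw).1 h
    have h2 : a • v = b • v := by
      rw [← hMv, ← hr, mulVec_smul, hMw, smul_comm]
    exact hab (smul_left_injective K hv h2)
  refine (congrArg Set.ncard ?_).trans (Set.ncard_pair hne)
  ext p
  induction p using Projectivization.ind with | h u hu => ?_
  rw [mem_fixedBy, PGL_smul_mk_eq_iff, Set.mem_insert_iff, Set.mem_singleton_iff,
    Projectivization.mk_eq_mk_iff', Projectivization.mk_eq_mk_iff']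
  constructor
  · rintro ⟨c, hc⟩
    rcases eigenvector_cases hab hv hw hMv hMw hu hc with h | h
    · exact Or.inl h.2
    · exact Or.inr h.2
  · rintro (⟨r, rfl⟩ | ⟨r, rfl⟩)
    · exact ⟨a, by rw [mulVec_smul, hMv, smul_comm]⟩
    · exact ⟨b, by rw [mulVec_smul, hMw, smul_comm]⟩

/-- The multiplier `det M / a²` at a fixed point with eigenvalue `a` depends only on the class of
`M` in `PGL₂`. -/
lemma multiplier_congr {M M' : GL (Fin 2) K}
    (h : (ProjGenLinGroup.mk M : PGL(2, K)) = ProjGenLinGroup.mk M') {v : Fin 2 → K} (hv : v ≠ 0)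
    {a a' : K} (ha : M.val *ᵥ v = a • v) (ha' : M'.val *ᵥ v = a' • v) :
    M.val.det / a ^ 2 = M'.val.det / a' ^ 2 := by
  obtain ⟨c, rfl⟩ := ProjGenLinGroup.mk_eq_mk_iff.1 h
  have hM : (M * GeneralLinearGroup.scalar (Fin 2) c).val = (c : K) • M.val := by
    ext i j
    simp [GeneralLinearGroup.scalar, mul_comm]
  rw [hM, smul_mulVec, ha, smul_smul] at ha'
  have : a' = c * a := (smul_left_injective K hv ha').symm
  rw [hM, this, det_smul, Fintype.card_fin, mul_pow, mul_div_mul_left _ _ (by simp)]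

lemma eigenvalue_ne_zero {M : GL (Fin 2) K} {v : Fin 2 → K} (hv : v ≠ 0)
    {a : K} (ha : M.val *ᵥ v = a • v) : a ≠ 0 := by
  rintro rfl
  rw [zero_smul] at ha
  have := congrArg ((M⁻¹).val *ᵥ ·) ha
  simp only [mulVec_mulVec, ← GeneralLinearGroup.coe_mul, inv_mul_cancel, mulVec_zero] at this
  simp at this
  exact hv this

variable {H : Type*} [Group H] (ρ : H →* PGL(2, K))

/-- The action of a group on the projective line through a homomorphism to `PGL₂`. -/
@[reducible]
noncomputable def projLineAction : MulAction H (ℙ K (Fin 2 → K)) := MulAction.compHom _ ρ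

theorem fixesTwoPoints_projLine [IsAlgClosed K] [CharZero K] [Finite H]
    (hρ : Function.Injective ρ) :
    letI := projLineAction ρ
    FixesTwoPoints H (ℙ K (Fin 2 → K)) := by
  let _ := projLineAction ρ
  intro h h1
  exact PGL_ncard_fixedBy (ρ.isOfFinOrder (isOfFinOrder_of_finite h))
    (fun h2 => h1 (hρ (by simpa using h2)))

/-- The multiplier character of the stabiliser of a point `p` of the projective line is injective
on finite groups. -/
theorem exists_multiplier_character [IsAlgClosed K] [CharZero K] [Finite H]
    (hρ : Function.Injective ρ) (p : ℙ K (Fin 2 → K)) :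
    letI := projLineAction ρ
    ∃ χ : stabilizer H p →* K, Function.Injective χ ∧
      ∀ (h : stabilizer H p) (M : GL (Fin 2) K), ProjGenLinGroup.mk M = ρ h →
        M.val.trace ^ 2 * χ h = (1 + χ h) ^ 2 * M.val.det := by
  let _ := projLineAction ρ
  induction p using Projectivization.ind with | h v hv => ?_
  have ex : ∀ h : stabilizer H (Projectivization.mk K v hv), ∃ (M : GL (Fin 2) K) (a : K),
      ProjGenLinGroup.mk M = ρ h ∧ M.val *ᵥ v = a • v := by
    intro h
    obtain ⟨M, hM⟩ := ProjGenLinGroup.mk_surjective (ρ h)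
    have h2 : ρ h • Projectivization.mk K v hv = Projectivization.mk K v hv := h.2
    rw [← hM, PGL_smul_mk_eq_iff] at h2
    obtain ⟨a, ha⟩ := h2
    exact ⟨M, a, hM, ha⟩
  choose M a hM ha using ex
  have key : ∀ (h : stabilizer H (Projectivization.mk K v hv)) (M' : GL (Fin 2) K) (a' : K),
      ProjGenLinGroup.mk M' = ρ h → M'.val *ᵥ v = a' • v →
      (M h).val.det / a h ^ 2 = M'.val.det / a' ^ 2 := fun h M' a' h1 h2 =>
    multiplier_congr ((hM h).trans h1.symm) hv (ha h) h2
  let χ : stabilizer H (Projectivization.mk K v hv) →* K :=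
    { toFun := fun h => (M h).val.det / a h ^ 2
      map_one' := by rw [key 1 1 1 (by simp) (by simp)]; simp
      map_mul' := fun g h => by
        rw [key (g * h) (M g * M h) (a g * a h) (by simp [hM]) (by
          rw [GeneralLinearGroup.coe_mul, ← mulVec_mulVec, ha, mulVec_smul, ha, smul_smul,
            mul_comm (a g)])]
        rw [GeneralLinearGroup.coe_mul, det_mul, mul_pow, mul_div_mul_comm] }
  refine ⟨χ, (injective_iff_map_eq_one χ).2 fun h hh => ?_, fun h M' hM' => ?_⟩
  · by_contra h1
    have h2 : (M h).val ∉ Set.range (scalar (Fin 2)) := fun h3 => by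
      rw [← PGL_mk_eq_one, hM] at h3
      exact h1 (Subtype.ext (hρ (by simpa using h3)))
    obtain ⟨n, hn, hMn⟩ := isOfFinOrder_iff_pow_eq_one.1
      (ρ.isOfFinOrder (isOfFinOrder_of_finite (h : H)))
    rw [← hM, PGL_mk_pow_eq_one] at hMn
    obtain ⟨b, c, w, w', hbc, hb, hc, hw, hw', hMw, hMw', -, hdet⟩ :=
      exists_eigenbasis hn.ne' hMn h2
    change (M h).val.det / a h ^ 2 = 1 at hh
    rw [div_eq_one_iff_eq (pow_ne_zero 2 (eigenvalue_ne_zero hv (ha h))), hdet] at hh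
    rcases eigenvector_cases hbc hw hw' hMw hMw' hv (ha h) with ⟨h3, -⟩ | ⟨h3, -⟩
    · rw [h3, sq] at hh
      exact hbc (mul_left_cancel₀ hb hh).symm
    · rw [h3, sq] at hh
      exact hbc (mul_right_cancel₀ hc hh)
  · obtain ⟨a', ha'⟩ : ∃ a', M'.val *ᵥ v = a' • v := by
      rw [← PGL_smul_mk_eq_iff hv, hM']
      exact h.2
    have hχ : χ h = M'.val.det / a' ^ 2 := key h M' a' hM' ha'
    have ha0 := eigenvalue_ne_zero hv ha'
    -- the characteristic equation of `M'` at the eigenvalue `a'`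
    have hchar : a' ^ 2 - M'.val.trace * a' + M'.val.det = 0 := by
      rw [← det_sub_scalar_fin_two]
      refine exists_mulVec_eq_zero_iff.1 ⟨v, hv, ?_⟩
      rw [sub_mulVec, ha', sub_eq_zero]
      ext i
      simp [scalar_apply, mulVec_diagonal]
    have htr : M'.val.trace = (a' ^ 2 + M'.val.det) / a' := by
      field_simp
      linear_combination -hchar
    rw [hχ, htr]
    field_simp

theorem isCyclic_stabilizer_projLine [IsAlgClosed K] [CharZero K] [Finite H]
    (hρ : Function.Injective ρ) (p : ℙ K (Fin 2 → K)) :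
    letI := projLineAction ρ
    IsCyclic (stabilizer H p) := by
  let _ := projLineAction ρ
  obtain ⟨χ, hχ, -⟩ := exists_multiplier_character ρ hρ p
  exact isCyclic_of_injective_ringHom χ hχ

/-- Two elements of a point stabiliser with the same value of `tr² / det` are equal or inverse to
each other. -/
theorem eq_or_eq_inv_of_trace_sq [IsAlgClosed K] [CharZero K] [Finite H]
    (hρ : Function.Injective ρ) (p : ℙ K (Fin 2 → K)) {g h : H} {M M' : GL (Fin 2) K}
    (hM : ProjGenLinGroup.mk M = ρ g) (hM' : ProjGenLinGroup.mk M' = ρ h) {τ : K}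
    (hτ : M.val.trace ^ 2 = τ * M.val.det) (hτ' : M'.val.trace ^ 2 = τ * M'.val.det)
    (hg : ρ g • p = p) (hh : ρ h • p = p) : h = g ∨ h = g⁻¹ := by
  let _ := projLineAction ρ
  obtain ⟨χ, hχ, hχ'⟩ := exists_multiplier_character ρ hρ p
  let g' : stabilizer H p := ⟨g, hg⟩
  let h' : stabilizer H p := ⟨h, hh⟩
  have h1 := hχ' g' M hM
  have h2 := hχ' h' M' hM'
  have hd : M.val.det ≠ 0 := M.det_ne_zero
  have hd' : M'.val.det ≠ 0 := M'.det_ne_zero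
  rw [hτ, mul_right_comm] at h1
  rw [hτ', mul_right_comm] at h2
  replace h1 := mul_right_cancel₀ hd h1
  replace h2 := mul_right_cancel₀ hd' h2
  have h0 : χ g' ≠ 0 := fun h => by simp [h] at h1
  have h3 : (χ h' - χ g') * (χ h' * χ g' - 1) = 0 := by
    linear_combination χ h' * h1 - χ g' * h2
  rcases mul_eq_zero.1 h3 with h4 | h4
  · exact Or.inl (congrArg Subtype.val (hχ (sub_eq_zero.1 h4)))
  · right
    rw [sub_eq_zero, ← map_mul, ← map_one χ] at h4
    exact eq_inv_of_mul_eq_one_left (congrArg Subtype.val (hχ h4))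

end PGL

/-! ### Automorphisms of a purely transcendental extension of degree one -/

section Moebius

open Matrix IntermediateField
open scoped MatrixGroups LinearAlgebra.Projectivization

lemma IsAlgClosed.mem_range_of_isAlgebraic {k K : Type*} [Field k] [IsAlgClosed k] [Field K]
    [Algebra k K] {x : K} (hx : IsAlgebraic k x) : ∃ c : k, algebraMap k K c = x := by
  have := isAlgebraic_adjoin_simple hx.isIntegral
  have h : x ∈ k⟮x⟯ := mem_adjoin_simple_self k x
  rwa [eq_bot_of_isAlgClosed_of_isAlgebraic k⟮x⟯, mem_bot] at h

variable {F L : Type*} [Field F] [Field L] [Algebra F L]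

/-- The matrix `A` over `F` represents the element `u` of `L` as a Möbius transform of `t`:
the vectors `A (t, 1)` and `(u, 1)` are proportional. -/
def MoebiusRep (t : L) (A : Matrix (Fin 2) (Fin 2) F) (u : L) : Prop :=
  ∃ j : L, j ≠ 0 ∧ A.map (algebraMap F L) *ᵥ ![t, 1] = j • ![u, 1]

lemma moebiusRep_iff {t : L} {A : Matrix (Fin 2) (Fin 2) F} {u : L} :
    MoebiusRep t A u ↔
      algebraMap F L (A 1 0) * t + algebraMap F L (A 1 1) ≠ 0 ∧
      algebraMap F L (A 0 0) * t + algebraMap F L (A 0 1) =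
        (algebraMap F L (A 1 0) * t + algebraMap F L (A 1 1)) * u := by
  constructor
  · rintro ⟨j, hj, h⟩
    have h0 := congrFun h 0
    have h1 := congrFun h 1
    simp [mulVec, dotProduct, Fin.sum_univ_two] at h0 h1
    rw [h1, h0]
    exact ⟨hj, rfl⟩
  · rintro ⟨h1, h2⟩
    refine ⟨_, h1, ?_⟩
    ext i
    fin_cases i <;> simp [mulVec, dotProduct, Fin.sum_univ_two, h2]

lemma algebraMap_of_mul_eq {t a b : L} {p q : F} (ht : Transcendental F t) (ha : a ≠ 0)
    (h : algebraMap F L p * a = algebraMap F L q * b) (hb : b = t * a) : p = 0 ∧ q = 0 := by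
  have h2 : algebraMap F L p = algebraMap F L q * t := by
    apply mul_right_cancel₀ ha
    rw [h, hb]; ring
  have hq : q = 0 := by
    by_contra hq
    apply ht
    have : t = algebraMap F L (p / q) := by
      rw [map_div₀, h2]
      field_simp [(map_ne_zero (algebraMap F L)).2 hq]
    rw [this]
    exact isAlgebraic_algebraMap _
  rw [hq, map_zero, zero_mul, map_eq_zero] at h2
  exact ⟨h2, hq⟩

lemma transcendental_of_adjoin_eq_top {t u : L} (ht : Transcendental F t) (hu : F⟮u⟯ = ⊤) :
    Transcendental F u := by
  intro h
  have := isAlgebraic_adjoin_simple h.isIntegral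
  rw [hu] at this
  have h2 := this.isAlgebraic (⟨t, mem_top⟩ : (⊤ : IntermediateField F L))
  exact ht ((isAlgebraic_algebraMap_iff (algebraMap (⊤ : IntermediateField F L) L).injective).2 h2)

/-- Another generator of the transcendental extension `F(t)` is a Möbius transform of `t`: the
degree of `F(t)` over `F(u)` is the degree of `u` as a rational function of `t`. -/
theorem exists_moebiusRep {t u : L} (ht : Transcendental F t) (htop : F⟮t⟯ = ⊤)
    (hu : F⟮u⟯ = ⊤) : ∃ A : GL (Fin 2) F, MoebiusRep t A.val u := by
  have hut := transcendental_of_adjoin_eq_top ht hu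
  let e : RatFunc F ≃ₐ[F] L :=
    (RatFunc.algEquivOfTranscendental t ht).trans ((equivOfEq htop).trans topEquiv)
  have heC : ∀ p : Polynomial F, e (algebraMap _ _ p) = Polynomial.aeval t p := by
    intro p
    change ((RatFunc.algEquivOfTranscendental t ht (algebraMap _ _ p) : F⟮t⟯) : L) = _
    rw [RatFunc.algEquivOfTranscendental_algebraMap]
    exact Polynomial.coe_aeval_mk_apply ..
  let f : RatFunc F := e.symm u
  have hf : F⟮f⟯ = ⊤ := by
    have h1 : (F⟮u⟯).map (e.symm : L →ₐ[F] RatFunc F) = F⟮f⟯ := by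
      rw [adjoin_map, Set.image_singleton]; rfl
    rw [← h1, hu, ← AlgHom.fieldRange_eq_map, AlgHom.fieldRange_eq_top]
    exact e.symm.surjective
  have hdeg := RatFunc.finrank_eq_max_natDegree f
  rw [hf, IntermediateField.finrank_top] at hdeg
  have hn : f.num.natDegree ≤ 1 := hdeg ▸ le_max_left _ _
  have hd : f.denom.natDegree ≤ 1 := hdeg ▸ le_max_right _ _
  obtain ⟨a, b, hab⟩ := Polynomial.exists_eq_X_add_C_of_natDegree_le_one hn
  obtain ⟨c, d, hcd⟩ := Polynomial.exists_eq_X_add_C_of_natDegree_le_one hd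
  have hden : e (algebraMap _ _ f.denom) ≠ 0 := by
    rw [ne_eq, map_eq_zero]
    exact RatFunc.algebraMap_ne_zero f.denom_ne_zero
  have hnum : e (algebraMap _ _ f.num) = e (algebraMap _ _ f.denom) * u := by
    have : u = e f := (e.apply_symm_apply u).symm
    rw [this, ← map_mul]
    conv_rhs => enter [2, 2]; rw [← RatFunc.num_div_denom f]
    rw [mul_div_cancel₀ _ (RatFunc.algebraMap_ne_zero f.denom_ne_zero)]
  rw [heC, hcd] at hden
  rw [heC, heC, hab, hcd] at hnum
  simp only [map_add, map_mul, Polynomial.aeval_C, Polynomial.aeval_X] at hnum hden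
  have hdet : (!![a, b; c, d]).det ≠ 0 := by
    rw [det_fin_two_of]
    intro h0
    have h1 : algebraMap F L a * algebraMap F L d = algebraMap F L b * algebraMap F L c := by
      rw [← map_mul, ← map_mul, sub_eq_zero.1 h0]
    have hc := algebraMap_of_mul_eq (p := a) (q := c) hut hden
      (b := algebraMap F L a * t + algebraMap F L b) (by linear_combination h1)
      (by rw [hnum, mul_comm])
    have hd := algebraMap_of_mul_eq (p := b) (q := d) hut hden
      (b := algebraMap F L a * t + algebraMap F L b) (by linear_combination -t * h1)
      (by rw [hnum, mul_comm])
    exact hden (by simp [hc.2, hd.2])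
  exact ⟨GeneralLinearGroup.mkOfDetNeZero _ hdet, moebiusRep_iff.2 ⟨hden, hnum⟩⟩

/-- The matrix representing a Möbius transform of a transcendental element is unique up to a
scalar. -/
theorem MoebiusRep.unique {t u : L} (ht : Transcendental F t) {A B : GL (Fin 2) F}
    (hA : MoebiusRep t A.val u) (hB : MoebiusRep t B.val u) :
    ∃ c : Fˣ, A * GeneralLinearGroup.scalar (Fin 2) c = B := by
  obtain ⟨i, hi, hA⟩ := hA
  obtain ⟨j, hj, hB⟩ := hB
  obtain ⟨M, hM⟩ : ∃ M, M = A⁻¹ * B := ⟨_, rfl⟩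
  have hAM : A * M = B := by rw [hM, mul_inv_cancel_left]
  have hv : M.val.map (algebraMap F L) *ᵥ ![t, 1] = (j / i) • ![t, 1] := by
    have hAA : A⁻¹.val.map (algebraMap F L) *ᵥ (A.val.map (algebraMap F L) *ᵥ ![t, 1]) =
        ![t, 1] := by
      rw [mulVec_mulVec, ← Matrix.map_mul, ← GeneralLinearGroup.coe_mul, inv_mul_cancel]
      simp
    rw [hA, mulVec_smul] at hAA
    rw [hM, GeneralLinearGroup.coe_mul, Matrix.map_mul, ← mulVec_mulVec, hB, mulVec_smul, ← hAA,
      smul_smul, div_mul_cancel₀ _ hi]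
  have h0 := congrFun hv 0
  have h1 := congrFun hv 1
  simp [mulVec, dotProduct, Fin.sum_univ_two] at h0 h1
  have hq : Polynomial.aeval t (Polynomial.C (M.val 1 0) * Polynomial.X ^ 2 +
      Polynomial.C (M.val 1 1 - M.val 0 0) * Polynomial.X + Polynomial.C (-M.val 0 1)) = 0 := by
    simp only [map_add, map_mul, map_pow, Polynomial.aeval_C, Polynomial.aeval_X, map_sub, map_neg]
    linear_combination t * h1 - h0
  have hq0 := (transcendental_iff.1 ht) _ hq
  have hc := congrArg (Polynomial.coeff · 2) hq0
  have hda := congrArg (Polynomial.coeff · 1) hq0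
  have hb := congrArg (Polynomial.coeff · 0) hq0
  simp [-map_sub, -map_neg, Polynomial.coeff_X, Polynomial.coeff_C] at hc hda hb
  have hMs : M.val = scalar (Fin 2) (M.val 0 0) := by
    ext p q
    fin_cases p <;> fin_cases q <;> simp [hb, hc, sub_eq_zero.1 hda]
  have hne : M.val 0 0 ≠ 0 := by
    intro h
    have := M.det_ne_zero
    rw [det_fin_two, h, hb] at this
    simp at this
  refine ⟨Units.mk0 _ hne, ?_⟩
  rw [← hAM]
  congr 1
  exact Units.ext hMs.symm

lemma MoebiusRep.comp {t : L} {A B : Matrix (Fin 2) (Fin 2) F} {φ ψ : L ≃ₐ[F] L}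
    (hA : MoebiusRep t A (φ t)) (hB : MoebiusRep t B (ψ t)) :
    MoebiusRep t (B * A) (φ (ψ t)) := by
  rw [moebiusRep_iff] at hB
  obtain ⟨i, hi, hA⟩ := hA
  obtain ⟨hB1, hB2⟩ := hB
  refine ⟨i * φ (algebraMap F L (B 1 0) * t + algebraMap F L (B 1 1)),
    mul_ne_zero hi ((map_ne_zero φ).2 hB1), ?_⟩
  rw [Matrix.map_mul, ← mulVec_mulVec, hA, mulVec_smul, ← smul_smul]
  congr 1
  have h2 := congrArg φ hB2
  simp only [map_add, map_mul, AlgEquiv.commutes] at h2 ⊢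
  ext p
  fin_cases p <;> simp [mulVec, dotProduct, Fin.sum_univ_two, h2]

lemma adjoin_apply_eq_top {t : L} (htop : F⟮t⟯ = ⊤) {σ : F ≃+* F} {g : L ≃+* L}
    (hg : ∀ x, g (algebraMap F L x) = algebraMap F L (σ x)) : F⟮g t⟯ = ⊤ := by
  rw [eq_top_iff]
  intro y _
  have key : ∀ x ∈ F⟮t⟯, g x ∈ F⟮g t⟯ := by
    intro x hx
    induction hx using adjoin_induction with
    | mem x hx => rw [Set.mem_singleton_iff.1 hx]; exact mem_adjoin_simple_self F _
    | algebraMap x => rw [hg]; exact IntermediateField.algebraMap_mem _ _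
    | add x y _ _ hx hy => rw [map_add]; exact add_mem hx hy
    | inv x _ hx => rw [map_inv₀]; exact inv_mem hx
    | mul x y _ _ hx hy => rw [map_mul]; exact mul_mem hx hy
  have := key (g.symm y) (htop ▸ mem_top)
  rwa [g.apply_symm_apply] at this

lemma AlgEquiv.eq_one_of_apply_generator {t : L} (htop : F⟮t⟯ = ⊤) {φ : L ≃ₐ[F] L}
    (h : φ t = t) : φ = 1 := by
  ext y
  have key : ∀ x ∈ F⟮t⟯, φ x = x := by
    intro x hx
    induction hx using adjoin_induction with
    | mem x hx => rw [Set.mem_singleton_iff.1 hx, h]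
    | algebraMap x => exact φ.commutes x
    | add x y _ _ hx hy => rw [map_add, hx, hy]
    | inv x _ hx => rw [map_inv₀, hx]
    | mul x y _ _ hx hy => rw [map_mul, hx, hy]
  exact key y (htop ▸ mem_top)

/-- Conjugating by a semilinear automorphism changes the matrix of an automorphism by the action
on the coefficients and a conjugation. -/
theorem MoebiusRep.conj {t : L} (ht : Transcendental F t) (htop : F⟮t⟯ = ⊤) {σ : F ≃+* F}
    {g : L ≃+* L} (hg : ∀ x, g (algebraMap F L x) = algebraMap F L (σ x)) {n m : L ≃ₐ[F] L}
    (hm : ∀ x, m (g x) = g (n x)) {A : GL (Fin 2) F} (hA : MoebiusRep t A.val (n t)) :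
    ∃ C : GL (Fin 2) F,
      MoebiusRep t (C⁻¹ * GeneralLinearGroup.map (σ : F →+* F) A * C).val (m t) := by
  obtain ⟨C, hC⟩ := exists_moebiusRep ht htop (adjoin_apply_eq_top htop hg)
  refine ⟨C, ?_⟩
  obtain ⟨hA1, hA2⟩ := moebiusRep_iff.1 hA
  obtain ⟨hC1, hC2⟩ := moebiusRep_iff.1 hC
  obtain ⟨j, hj, hC⟩ := hC
  let i := algebraMap F L (A.val 1 0) * t + algebraMap F L (A.val 1 1)
  let l := algebraMap F L (C.val 1 0) * t + algebraMap F L (C.val 1 1)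
  have hgA : (GeneralLinearGroup.map (σ : F →+* F) A).val.map (algebraMap F L) *ᵥ ![g t, 1] =
      g i • ![m (g t), 1] := by
    have h := congrArg g hA2
    simp only [map_add, map_mul, hg, ← hm] at h
    ext p
    fin_cases p <;> simp [i, mulVec, dotProduct, Fin.sum_univ_two, h, hg]
  have hmC : C.val.map (algebraMap F L) *ᵥ ![m t, 1] = m l • ![m (g t), 1] := by
    have h := congrArg m hC2
    simp only [map_add, map_mul, AlgEquiv.commutes] at h
    ext p
    fin_cases p <;> simp [l, mulVec, dotProduct, Fin.sum_univ_two, h]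
  have hml : m l ≠ 0 := (map_ne_zero m).2 hC1
  refine ⟨j * g i * (m l)⁻¹, mul_ne_zero (mul_ne_zero hj ((map_ne_zero g).2 hA1))
    (inv_ne_zero hml), ?_⟩
  have hCC : C⁻¹.val.map (algebraMap F L) *ᵥ (C.val.map (algebraMap F L) *ᵥ ![m t, 1]) =
      ![m t, 1] := by
    rw [mulVec_mulVec, ← Matrix.map_mul, ← GeneralLinearGroup.coe_mul, inv_mul_cancel]
    simp
  rw [hmC, mulVec_smul] at hCC
  rw [GeneralLinearGroup.coe_mul, GeneralLinearGroup.coe_mul, Matrix.map_mul, Matrix.map_mul,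
    ← mulVec_mulVec, ← mulVec_mulVec, hC, mulVec_smul, hgA, mulVec_smul, mulVec_smul]
  conv_rhs => rw [← hCC]
  rw [smul_smul, smul_smul, mul_assoc _ _ (m l), inv_mul_cancel₀ hml, mul_one]

variable (F) in
/-- Automorphisms of `F(t)` over `F` embed into `PGL₂` over an algebraic closure of `F`. The
matrices representing `φ t` multiply in the opposite order, which accounts for the inverse. -/
theorem exists_hom_PGL {t : L} (ht : Transcendental F t) (htop : F⟮t⟯ = ⊤) :
    ∃ ρ : (L ≃ₐ[F] L) →* PGL(2, AlgebraicClosure F), Function.Injective ρ ∧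
      ∀ (φ : L ≃ₐ[F] L) (A : GL (Fin 2) F), MoebiusRep t A.val (φ t) →
        ProjGenLinGroup.mk (GeneralLinearGroup.map (algebraMap F (AlgebraicClosure F)) A) =
          ρ φ⁻¹ := by
  let ι := GeneralLinearGroup.map (n := Fin 2) (algebraMap F (AlgebraicClosure F))
  have ex (φ : L ≃ₐ[F] L) : ∃ A : GL (Fin 2) F, MoebiusRep t A.val (φ t) :=
    exists_moebiusRep ht htop
      (adjoin_apply_eq_top htop (σ := RingEquiv.refl F) (g := φ) (fun x => by simp))
  choose A hA using ex
  have key (φ : L ≃ₐ[F] L) (B : GL (Fin 2) F) (hB : MoebiusRep t B.val (φ t)) :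
      (ProjGenLinGroup.mk (ι (A φ)) : PGL(2, AlgebraicClosure F)) =
        ProjGenLinGroup.mk (ι B) := by
    obtain ⟨c, hc⟩ := (hA φ).unique ht hB
    rw [← hc, map_mul, map_mul, GeneralLinearGroup.map_scalar, ProjGenLinGroup.mk_scalar, mul_one]
  let ρ : (L ≃ₐ[F] L) →* PGL(2, AlgebraicClosure F) := MonoidHom.mk'
    (fun φ => (ProjGenLinGroup.mk (ι (A φ)))⁻¹) fun φ ψ => by
      rw [key (φ * ψ) (A ψ * A φ) ((hA φ).comp (hA ψ)), map_mul, map_mul, _root_.mul_inv_rev]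
  refine ⟨ρ, (injective_iff_map_eq_one ρ).2 fun φ hφ => ?_, fun φ B hB => ?_⟩
  · change (ProjGenLinGroup.mk (ι (A φ)))⁻¹ = 1 at hφ
    rw [inv_eq_one, PGL_mk_eq_one] at hφ
    obtain ⟨c, hc⟩ := hφ
    have hcoe (p q) : algebraMap F (AlgebraicClosure F) ((A φ).val p q) =
        scalar (Fin 2) c p q := by rw [hc]; rfl
    have h01 : (A φ).val 0 1 = 0 := by simpa using hcoe 0 1
    have h10 : (A φ).val 1 0 = 0 := by simpa using hcoe 1 0
    have h11 : (A φ).val 0 0 = (A φ).val 1 1 :=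
      (algebraMap F (AlgebraicClosure F)).injective (by rw [hcoe, hcoe]; simp)
    obtain ⟨h1, h2⟩ := moebiusRep_iff.1 (hA φ)
    rw [h10, map_zero, zero_mul, zero_add] at h1
    rw [h01, h10, h11, map_zero, zero_mul, add_zero, zero_add] at h2
    exact AlgEquiv.eq_one_of_apply_generator htop (mul_left_cancel₀ h1 h2).symm
  · rw [map_inv, ← key φ B hB]
    exact (inv_inv _).symm

/-- For a matrix of finite order modulo scalars, `tr² / det` is `ζ + ζ⁻¹ + 2` for a root of unity
`ζ`, so it lies in every algebraically closed subfield. -/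
theorem exists_trace_sq_eq {k K : Type*} [Field k] [IsAlgClosed k] [Field K] [IsAlgClosed K]
    [CharZero K] [Algebra k K] {M : GL (Fin 2) K}
    (hM : IsOfFinOrder (ProjGenLinGroup.mk M : PGL(2, K))) :
    ∃ κ : k, M.val.trace ^ 2 = algebraMap k K κ * M.val.det := by
  obtain ⟨n, hn, hMn⟩ := isOfFinOrder_iff_pow_eq_one.1 hM
  rw [PGL_mk_pow_eq_one] at hMn
  by_cases hs : M.val ∈ Set.range (scalar (Fin 2))
  · obtain ⟨c, hc⟩ := hs
    refine ⟨4, ?_⟩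
    rw [← hc, trace_fin_two, det_fin_two, map_ofNat]
    simp
    ring
  · obtain ⟨a, b, v, w, -, ha, hb, hv, hw, hMv, hMw, htr, hdet⟩ := exists_eigenbasis hn.ne' hMn hs
    have hpow : ∀ (c : K) (u : Fin 2 → K), M.val *ᵥ u = c • u →
        ∀ m : ℕ, (M ^ m).val *ᵥ u = c ^ m • u := by
      intro c u hu m
      induction m with
      | zero => simp
      | succ m ih =>
        rw [pow_succ, GeneralLinearGroup.coe_mul, ← mulVec_mulVec, hu, mulVec_smul, ih, smul_smul,
          ← pow_succ']
    obtain ⟨s, hs⟩ := hMn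
    have hsc : ∀ (c : K) (u : Fin 2 → K), u ≠ 0 → M.val *ᵥ u = c • u → c ^ n = s := by
      intro c u hu h
      have h1 := hpow c u h n
      have h2 : scalar (Fin 2) s *ᵥ u = s • u := by
        ext i; simp [scalar_apply, mulVec_diagonal]
      rw [← hs, h2] at h1
      exact (smul_left_injective K hu h1).symm
    have hζ : (a / b) ^ n = 1 := by
      rw [div_pow, hsc a v hv hMv, hsc b w hw hMw, div_self]
      rw [← hsc b w hw hMw]
      exact pow_ne_zero n hb
    obtain ⟨ζ, hζ'⟩ := IsAlgClosed.mem_range_of_isAlgebraic (k := k) (x := a / b)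
      ⟨Polynomial.X ^ n - 1, Polynomial.X_pow_sub_C_ne_zero hn 1, by simp [hζ]⟩
    have hζ0 : a / b ≠ 0 := div_ne_zero ha hb
    refine ⟨ζ + ζ⁻¹ + 2, ?_⟩
    rw [map_add, map_add, map_inv₀, hζ', htr, hdet, map_ofNat]
    field_simp
    ring

lemma trace_sq_map_iff {F' : Type*} [Field F'] [Algebra F F'] {A : GL (Fin 2) F} {κ : F} :
    (GeneralLinearGroup.map (algebraMap F F') A).val.trace ^ 2 =
      algebraMap F F' κ * (GeneralLinearGroup.map (algebraMap F F') A).val.det ↔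
    A.val.trace ^ 2 = κ * A.val.det := by
  have htr : (GeneralLinearGroup.map (algebraMap F F') A).val.trace =
      algebraMap F F' A.val.trace := by
    simp [trace_fin_two]
  have hdet : (GeneralLinearGroup.map (algebraMap F F') A).val.det =
      algebraMap F F' A.val.det := by
    simp [det_fin_two]
  rw [htr, hdet, ← map_pow, ← map_mul, (algebraMap F F').injective.eq_iff]

/-- In a finite group `G` of `k`-automorphisms of `F(t)` that preserves `F`, the subgroup acting
trivially on `F` is a finite group of Möbius transformations, hence polyhedral, small, cyclic or
dihedral. In the last two cases, conjugation by `G` preserves a generator of the rotation subgroup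
up to inversion, since it preserves the invariant `tr² / det`, which lies in `k`. -/
theorem fibreType_ker {k : Type*} [Field k] [IsAlgClosed k] [CharZero F] [Algebra k F]
    [Algebra k L] [IsScalarTower k F L] {t : L} (ht : Transcendental F t) (htop : F⟮t⟯ = ⊤)
    {G : Type*} [Group G] [Finite G] (γ : G →* (L ≃ₐ[k] L)) (hγ : Function.Injective γ)
    (σ : G →* (F ≃ₐ[k] F)) (hσ : ∀ g x, γ g (algebraMap F L x) = algebraMap F L (σ g x)) :
    FibreType σ.ker := by
  let N := σ.ker
  let ν : N →* (L ≃ₐ[F] L) :=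
    { toFun := fun n => AlgEquiv.ofRingEquiv (f := (γ n : L ≃+* L)) fun x => by
        have : σ n = 1 := n.2
        simp [hσ, this]
      map_one' := by ext; simp
      map_mul' := fun m n => by ext; simp }
  have hν : ∀ (n : N) (x : L), ν n x = γ n x := fun _ _ => rfl
  have hνinj : Function.Injective ν := fun m n h =>
    Subtype.ext (hγ (AlgEquiv.ext fun x => by rw [← hν, h, hν]))
  obtain ⟨ρ₀, hρ₀, hrep⟩ := exists_hom_PGL F ht htop
  let ρ : N →* PGL(2, AlgebraicClosure F) := ρ₀.comp ν
  have hρ : Function.Injective ρ := hρ₀.comp hνinj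
  let _ := projLineAction ρ
  have hfix := fixesTwoPoints_projLine ρ hρ
  have hcyc := isCyclic_stabilizer_projLine ρ hρ
  have : CharZero (AlgebraicClosure F) := charZero_of_injective_algebraMap
    (algebraMap F (AlgebraicClosure F)).injective
  have hne : Nonempty (ℙ (AlgebraicClosure F) (Fin 2 → AlgebraicClosure F)) :=
    ⟨Projectivization.mk _ ![1, 0] (by simp)⟩
  by_cases hex : ∃ p : ℙ (AlgebraicClosure F) (Fin 2 → AlgebraicClosure F),
      (MulAction.stabilizer N p).index ≤ 2
  · obtain ⟨p, hp⟩ := hex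
    obtain ⟨⟨c, hcp⟩, hc⟩ := IsCyclic.exists_generator (α := MulAction.stabilizer N p)
    have hstab : MulAction.stabilizer N p = Subgroup.zpowers c := by
      ext x
      constructor
      · intro hx
        obtain ⟨i, hi⟩ := hc ⟨x, hx⟩
        exact ⟨i, congrArg Subtype.val hi⟩
      · rintro ⟨i, rfl⟩
        exact zpow_mem hcp i
    by_cases hc2 : c ^ 2 = 1
    · refine FibreType.small ?_
      have h1 : Nat.card (MulAction.stabilizer N p) ≤ 2 := by
        rw [hstab, Nat.card_zpowers]
        exact orderOf_le_of_pow_eq_one (by norm_num) hc2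
      rw [← (MulAction.stabilizer N p).index_mul_card]
      exact Nat.mul_le_mul hp h1
    · refine FibreType.dihedral (c : G) c.2 ?_ ?_ ?_
      · rw [Subgroup.relIndex]
        refine le_of_eq_of_le (congrArg Subgroup.index ?_) hp
        rw [hstab]
        ext x
        rw [Subgroup.mem_subgroupOf, Subgroup.mem_zpowers_iff, Subgroup.mem_zpowers_iff]
        exact exists_congr fun i => by rw [← Subgroup.coe_zpow, Subtype.ext_iff]
      · intro x hx hxc
        have h1 : (⟨x, hx⟩ : N) ∈ MulAction.stabilizer N p :=
          hfix.mem_stabilizer_of_commute hcp hc2 (Subtype.ext hxc)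
        rw [hstab] at h1
        obtain ⟨i, hi⟩ := h1
        exact ⟨i, congrArg Subtype.val hi⟩
      · intro g
        let d : N := MulAut.conjNormal g c
        have hd : d ∈ MulAction.stabilizer N p := hfix.stabilizer_invariant hp hc2 _
        -- the matrices of `c` and of its conjugate `d` have the same `tr² / det`
        obtain ⟨A, hA⟩ := exists_moebiusRep ht htop
          (adjoin_apply_eq_top htop (σ := RingEquiv.refl F) (g := (ν c : L ≃+* L))
            (fun x => by simp))
        obtain ⟨C, hC⟩ := MoebiusRep.conj ht htop (σ := (σ g : F ≃+* F)) (g := (γ g : L ≃+* L))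
          (fun x => hσ g x) (n := ν c) (m := ν d) (fun x => by
            change γ d (γ g x) = γ g (γ c x)
            simp only [d, MulAut.conjNormal_apply, ← AlgEquiv.mul_apply, ← map_mul,
              inv_mul_cancel_right]) hA
        have h1 := hrep (ν c) A hA
        have h2 := hrep (ν d) _ hC
        rw [← map_inv] at h1 h2
        have hfin : IsOfFinOrder (ProjGenLinGroup.mk
            (GeneralLinearGroup.map (algebraMap F (AlgebraicClosure F)) A) :
              PGL(2, AlgebraicClosure F)) := by
          rw [h1]
          exact ρ.isOfFinOrder (isOfFinOrder_of_finite c⁻¹)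
        obtain ⟨κ, hκ⟩ := exists_trace_sq_eq (k := k) hfin
        rw [IsScalarTower.algebraMap_apply k F (AlgebraicClosure F)] at hκ
        have hκF := trace_sq_map_iff.1 hκ
        have hκC : (C⁻¹ * GeneralLinearGroup.map (σ g : F →+* F) A * C).val.trace ^ 2 =
            algebraMap k F κ *
              (C⁻¹ * GeneralLinearGroup.map (σ g : F →+* F) A * C).val.det := by
          have ht1 : (C⁻¹ * GeneralLinearGroup.map (σ g : F →+* F) A * C).val.trace =
              σ g A.val.trace := by
            rw [mul_assoc, GeneralLinearGroup.coe_mul, trace_mul_comm,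
              ← GeneralLinearGroup.coe_mul, mul_inv_cancel_right, trace_fin_two, trace_fin_two]
            simp
          have hd1 : (C⁻¹ * GeneralLinearGroup.map (σ g : F →+* F) A * C).val.det =
              σ g A.val.det := by
            rw [mul_assoc, GeneralLinearGroup.coe_mul, det_mul_comm,
              ← GeneralLinearGroup.coe_mul, mul_inv_cancel_right, det_fin_two, det_fin_two]
            simp
          rw [ht1, hd1, ← map_pow, hκF, map_mul, AlgEquiv.commutes]
        have hcp' : ρ c⁻¹ • p = p := inv_mem hcp
        have hdp' : ρ d⁻¹ • p = p := inv_mem hd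
        rcases eq_or_eq_inv_of_trace_sq ρ hρ p (g := c⁻¹) (h := d⁻¹) h1 h2 hκ
          (trace_sq_map_iff.2 hκC) hcp' hdp' with h | h
        · exact Or.inl (congrArg Subtype.val (inv_injective h))
        · right
          have hdc : d = c⁻¹ := by rw [← inv_inv d, h, inv_inv]
          exact congrArg Subtype.val hdc
  · obtain ⟨h60, a, b, hab⟩ := hfix.two_generated hcyc hex
    exact FibreType.polyhedral h60 (hfix.center_eq_bot hex) a b hab

/-- A finite group of automorphisms of a field generated by one element over an algebraically
closed field of constants has order at most sixty or a cyclic subgroup of index at most two. -/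
theorem card_le_or_exists_isCyclic {k K : Type*} [Field k] [IsAlgClosed k] [CharZero k] [Field K]
    [Algebra k K] {s : K} (hs : k⟮s⟯ = ⊤) {Q : Type*} [Group Q] [Finite Q]
    (γ : Q →* (K ≃ₐ[k] K)) (hγ : Function.Injective γ) :
    Nat.card Q ≤ 60 ∨ ∃ C : Subgroup Q, C.index ≤ 2 ∧ IsCyclic C := by
  by_cases hst : Transcendental k s
  · obtain ⟨ρ₀, hρ₀, -⟩ := exists_hom_PGL k hst hs
    let ρ := ρ₀.comp γ
    have hρ : Function.Injective ρ := hρ₀.comp hγ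
    let _ := projLineAction ρ
    have : CharZero (AlgebraicClosure k) := charZero_of_injective_algebraMap
      (algebraMap k (AlgebraicClosure k)).injective
    have hne : Nonempty (ℙ (AlgebraicClosure k) (Fin 2 → AlgebraicClosure k)) :=
      ⟨Projectivization.mk _ ![1, 0] (by simp)⟩
    have hfix := fixesTwoPoints_projLine ρ hρ
    have hcyc := isCyclic_stabilizer_projLine ρ hρ
    by_cases hex : ∃ p : ℙ (AlgebraicClosure k) (Fin 2 → AlgebraicClosure k),
        (MulAction.stabilizer Q p).index ≤ 2
    · obtain ⟨p, hp⟩ := hex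
      exact Or.inr ⟨_, hp, hcyc p⟩
    · exact Or.inl (hfix.two_generated hcyc hex).1
  · left
    obtain ⟨c, rfl⟩ := IsAlgClosed.mem_range_of_isAlgebraic (not_not.1 hst)
    have hone : ∀ q : Q, q = 1 := fun q => hγ (by
      rw [AlgEquiv.eq_one_of_apply_generator hs (AlgEquiv.commutes (γ q) c), map_one])
    have : Subsingleton Q := ⟨fun a b => (hone a).trans (hone b).symm⟩
    rw [Nat.card_of_subsingleton (1 : Q)]
    norm_num

end Moebius

/-! ### Ternary quadratic forms over a rational function field -/

section Tsen

open Polynomial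

variable {k : Type*} [Field k] [IsAlgClosed k]

/-- Over an algebraically closed field, every polynomial is a square modulo a squarefree one. -/
lemma Polynomial.exists_dvd_sq_sub {a b : k[X]} (hb : Squarefree b) :
    ∃ r : k[X], b ∣ r ^ 2 - a ∧ r.degree < b.degree := by
  classical
  have hb0 := hb.ne_zero
  choose f hf using fun c : k => IsAlgClosed.exists_pow_nat_eq (a.eval c) (n := 2) (by norm_num)
  have hinj : Set.InjOn (id : k → k) (b.roots.toFinset : Set k) := Function.injective_id.injOn
  have hnd : b.roots.Nodup := nodup_roots (PerfectField.separable_iff_squarefree.2 hb)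
  have hcard : b.roots.toFinset.card = b.natDegree := by
    rw [Multiset.toFinset_card_of_nodup hnd, IsAlgClosed.card_roots_eq_natDegree]
  refine ⟨Lagrange.interpolate b.roots.toFinset id f, ?_, ?_⟩
  · by_cases h0 : (Lagrange.interpolate b.roots.toFinset id f) ^ 2 - a = 0
    · rw [h0]; exact dvd_zero _
    rw [IsAlgClosed.dvd_iff_roots_le_roots hb0 h0, Multiset.le_iff_subset hnd]
    intro c hc
    rw [mem_roots h0, IsRoot, eval_sub, eval_pow]
    have := Lagrange.eval_interpolate_at_node f hinj (Multiset.mem_toFinset.2 hc)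
    rw [id] at this
    rw [this, hf, sub_self]
  · rw [degree_eq_natDegree hb0, ← hcard]
    exact Lagrange.degree_interpolate_lt f hinj

/-- Legendre's descent: `a x² + b y² = z²` has a nontrivial solution in polynomials. If `b` is
squarefree of degree at least that of `a`, then `r² - a = b b'` with `b'` of smaller degree, and a
solution for `(a, b')` yields one for `(a, b)` by multiplicativity of the norm `z² - a x²`. -/
theorem Polynomial.exists_legendre (n : ℕ) : ∀ a b : k[X], a ≠ 0 → b ≠ 0 →
    a.natDegree + b.natDegree ≤ n →
    ∃ x y z : k[X], (x ≠ 0 ∨ y ≠ 0 ∨ z ≠ 0) ∧ a * x ^ 2 + b * y ^ 2 = z ^ 2 := by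
  induction n using Nat.strong_induction_on with | _ n ih => ?_
  -- the descent step when `b` has the larger degree
  have step : ∀ a b : k[X], a ≠ 0 → b ≠ 0 → a.natDegree + b.natDegree ≤ n →
      a.natDegree ≤ b.natDegree →
      ∃ x y z : k[X], (x ≠ 0 ∨ y ≠ 0 ∨ z ≠ 0) ∧ a * x ^ 2 + b * y ^ 2 = z ^ 2 := by
    intro a b ha hb hn hab
    rcases Nat.eq_zero_or_pos b.natDegree with hb1 | hb1
    · obtain ⟨c, hc⟩ := natDegree_eq_zero.1 (Nat.le_zero.1 (hb1 ▸ hab))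
      obtain ⟨d, hd⟩ := IsAlgClosed.exists_pow_nat_eq c (n := 2) (by norm_num)
      exact ⟨1, 0, C d, Or.inl one_ne_zero, by rw [← hc, ← hd, C_pow]; ring⟩
    by_cases hsq : Squarefree b
    · obtain ⟨r, ⟨b', hb'⟩, hr⟩ := Polynomial.exists_dvd_sq_sub (a := a) hsq
      by_cases hb0 : b' = 0
      · exact ⟨1, 0, r, Or.inl one_ne_zero, by
          rw [hb0, mul_zero, sub_eq_zero] at hb'; rw [hb']; ring⟩
      have hrd : r.natDegree < b.natDegree := by
        rcases eq_or_ne r 0 with rfl | hr0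
        · simpa using hb1
        · exact natDegree_lt_natDegree hr0 hr
      have hdeg : b.natDegree + b'.natDegree ≤ max (2 * r.natDegree) a.natDegree := by
        rw [← natDegree_mul hb hb0, ← hb', ← natDegree_pow]
        exact natDegree_sub_le _ _
      have hlt : b'.natDegree < b.natDegree := by
        rcases max_cases (2 * r.natDegree) a.natDegree with h | h <;> omega
      obtain ⟨x, y, z, hne, h⟩ := ih (a.natDegree + b'.natDegree) (by omega) a b' ha hb0 le_rfl
      by_cases hy : y = 0
      · refine ⟨x, 0, z, by tauto, ?_⟩
        rw [← h, hy]; ring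
      · refine ⟨z + r * x, b' * y, r * z + a * x, Or.inr (Or.inl (mul_ne_zero hb0 hy)), ?_⟩
        linear_combination (a * x ^ 2 - z ^ 2) * hb' + b * b' * h
    · rw [Squarefree] at hsq
      push Not at hsq
      obtain ⟨c, ⟨d, hd⟩, hc⟩ := hsq
      have hc0 : c ≠ 0 := by rintro rfl; simp [hd] at hb
      have hd0 : d ≠ 0 := by rintro rfl; simp [hd] at hb
      have hcd : 0 < c.natDegree := by
        by_contra h
        obtain ⟨e, rfl⟩ := natDegree_eq_zero.1 (by omega : c.natDegree = 0)
        exact hc (isUnit_C.2 (isUnit_iff_ne_zero.2 (fun h => hc0 (by simp [h]))))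
      have hdeg : b.natDegree = c.natDegree + c.natDegree + d.natDegree := by
        rw [hd, natDegree_mul (mul_ne_zero hc0 hc0) hd0, natDegree_mul hc0 hc0]
      obtain ⟨x, y, z, hne, h⟩ := ih (a.natDegree + d.natDegree) (by omega) a d ha hd0 le_rfl
      refine ⟨c * x, y, c * z, ?_, ?_⟩
      · simpa [hc0] using hne
      · rw [hd]; linear_combination c ^ 2 * h
  intro a b ha hb hn
  rcases le_total a.natDegree b.natDegree with h | h
  · exact step a b ha hb hn h
  · obtain ⟨x, y, z, hne, hxyz⟩ := step b a hb ha (by omega) h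
    exact ⟨y, x, z, by tauto, by rw [← hxyz]; ring⟩

open IntermediateField in
/-- In `K = k(s)`, the form `a x² + b y² - z²` is isotropic. -/
lemma exists_legendre_of_adjoin {K : Type*} [Field K] [Algebra k K] {s : K} (hs : k⟮s⟯ = ⊤)
    (a b : K) : ∃ x y z : K, (x ≠ 0 ∨ y ≠ 0 ∨ z ≠ 0) ∧ a * x ^ 2 + b * y ^ 2 = z ^ 2 := by
  by_cases hst : Transcendental k s
  · have ex (a : K) : ∃ (p : k[X]) (d : K), d ≠ 0 ∧ a * d ^ 2 = aeval s p := by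
      obtain ⟨p, q, hpq⟩ := (mem_adjoin_simple_iff k a).1 (hs ▸ mem_top)
      by_cases hq : aeval s q = 0
      · exact ⟨0, 1, one_ne_zero, by simp [hpq, hq]⟩
      · exact ⟨p * q, aeval s q, hq, by rw [hpq, map_mul]; field_simp⟩
    have inj (p : k[X]) (h : aeval s p = 0) : p = 0 := (transcendental_iff.1 hst) p h
    obtain ⟨p, d, hd, hp⟩ := ex a
    obtain ⟨q, e, he, hq⟩ := ex b
    rcases eq_or_ne p 0 with rfl | hp0
    · refine ⟨1, 0, 0, Or.inl one_ne_zero, ?_⟩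
      have : a = 0 := by simpa [hd] using hp
      simp [this]
    rcases eq_or_ne q 0 with rfl | hq0
    · refine ⟨0, 1, 0, Or.inr (Or.inl one_ne_zero), ?_⟩
      have : b = 0 := by simpa [he] using hq
      simp [this]
    obtain ⟨x, y, z, hne, h⟩ := Polynomial.exists_legendre _ p q hp0 hq0 le_rfl
    refine ⟨d * aeval s x, e * aeval s y, aeval s z, ?_, ?_⟩
    · rcases hne with h | h | h
      · exact Or.inl (mul_ne_zero hd fun h' => h (inj _ h'))
      · exact Or.inr (Or.inl (mul_ne_zero he fun h' => h (inj _ h')))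
      · exact Or.inr (Or.inr fun h' => h (inj _ h'))
    · have := congrArg (aeval s) h
      simp only [map_add, map_mul, map_pow] at this
      rw [← this, ← hp, ← hq]
      ring
  · obtain ⟨c, rfl⟩ := IsAlgClosed.mem_range_of_isAlgebraic (not_not.1 hst)
    have ha : IsAlgebraic k a := by
      have := isAlgebraic_adjoin_simple (isAlgebraic_algebraMap (A := K) c).isIntegral
      rw [hs] at this
      exact (isAlgebraic_algebraMap_iff (algebraMap (⊤ : IntermediateField k K) K).injective).2
        (this.isAlgebraic (⟨a, mem_top⟩ : (⊤ : IntermediateField k K)))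
    obtain ⟨a', rfl⟩ := IsAlgClosed.mem_range_of_isAlgebraic ha
    obtain ⟨d, hd⟩ := IsAlgClosed.exists_pow_nat_eq a' (n := 2) (by norm_num)
    exact ⟨1, 0, algebraMap k K d, Or.inl one_ne_zero, by rw [← hd, map_pow]; ring⟩

/-- The value at `(x, y, z)` of the ternary quadratic form with the given coefficients. -/
def ternaryForm {R : Type*} [CommRing R] (a b c d e f x y z : R) : R :=
  a * x ^ 2 + b * y ^ 2 + c * z ^ 2 + d * (y * z) + e * (x * z) + f * (x * y)

open IntermediateField in
/-- Ternary quadratic forms over `k(s)` are isotropic, by completing squares and the diagonal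
case. -/
theorem exists_isotropic {K : Type*} [Field K] [CharZero K] [Algebra k K] {s : K} (hs : k⟮s⟯ = ⊤)
    (a b c d e f : K) :
    ∃ x y z : K, (x ≠ 0 ∨ y ≠ 0 ∨ z ≠ 0) ∧ ternaryForm a b c d e f x y z = 0 := by
  rcases eq_or_ne a 0 with rfl | ha
  · exact ⟨1, 0, 0, Or.inl one_ne_zero, by simp [ternaryForm]⟩
  obtain ⟨b', hb'⟩ : ∃ b', b' = 4 * a * b - f ^ 2 := ⟨_, rfl⟩
  obtain ⟨d', hd'⟩ : ∃ d', d' = 2 * a * d - e * f := ⟨_, rfl⟩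
  obtain ⟨c', hc'⟩ : ∃ c', c' = 4 * a * c - e ^ 2 := ⟨_, rfl⟩
  have h2 : (2 : K) ≠ 0 := two_ne_zero
  rcases eq_or_ne b' 0 with h | hb0
  · refine ⟨-f, 2 * a, 0, Or.inr (Or.inl (mul_ne_zero h2 ha)), ?_⟩
    rw [ternaryForm]
    linear_combination (-a) * (hb'.symm.trans h) + 2 * a * (hb'.symm.trans h)
  -- `16 a b' q = 4 b' u² + v² + (…) z²` for `u = 2 a x + f y + e z`, `v = 2 b' y + 2 d' z`
  obtain ⟨v, z, u, hne, h⟩ := exists_legendre_of_adjoin hs (-b'⁻¹) (-(c' - d' ^ 2 / b'))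
  refine ⟨(u - f * ((v - d' * z) / b') - e * z) / (2 * a), (v - d' * z) / b', z, ?_, ?_⟩
  · by_contra! hcon
    obtain ⟨hx, hy, rfl⟩ := hcon
    have hv : v = 0 := by simpa [hb0] using hy
    have hu : u = 0 := by simpa [hv, ha, h2] using hx
    simp [hv, hu] at hne
  · rw [ternaryForm]
    have h4 : 4 * a ≠ 0 := mul_ne_zero (by norm_num) ha
    apply mul_left_cancel₀ h4
    rw [mul_zero]
    have hcalc : 4 * a * (a * ((u - f * ((v - d' * z) / b') - e * z) / (2 * a)) ^ 2 +
        b * ((v - d' * z) / b') ^ 2 + c * z ^ 2 + d * ((v - d' * z) / b' * z) +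
        e * ((u - f * ((v - d' * z) / b') - e * z) / (2 * a) * z) +
        f * ((u - f * ((v - d' * z) / b') - e * z) / (2 * a) * ((v - d' * z) / b'))) =
        u ^ 2 + (4 * a * b - f ^ 2) * ((v - d' * z) / b') ^ 2 + (4 * a * c - e ^ 2) * z ^ 2 +
          2 * (2 * a * d - e * f) * ((v - d' * z) / b' * z) := by
      field_simp
      ring
    rw [hcalc, ← hb', ← hc', ← hd', ← h]
    field_simp
    ring

end Tsen

/-! ### Function fields of conics -/

section Conic

open IntermediateField MvPolynomial

variable {K L : Type*} [Field K] [Field L] [Algebra K L]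

lemma transcendental_of_adjoin_eq_top_of_not_isAlgebraic (hL : ¬ Algebra.IsAlgebraic K L)
    (F : IntermediateField K L) [Algebra.IsAlgebraic K F] {t : L} (ht : F⟮t⟯ = ⊤) :
    Transcendental F t := by
  intro h
  apply hL
  have h1 : Algebra.IsAlgebraic F F⟮t⟯ := isAlgebraic_adjoin_simple h.isIntegral
  rw [ht] at h1
  have h2 : Algebra.IsAlgebraic F L :=
    ⟨fun x => (isAlgebraic_algebraMap_iff
      (algebraMap (⊤ : IntermediateField F L) L).injective).2
        (h1.isAlgebraic (⟨x, mem_top⟩ : (⊤ : IntermediateField F L)))⟩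
  exact Algebra.IsAlgebraic.trans K F L

lemma adjoin_simple_eq_top_of_mem {F : IntermediateField K L} {t : L}
    (h : ∀ E : IntermediateField K L, F ≤ E → t ∈ E → E = ⊤) : F⟮t⟯ = ⊤ := by
  apply restrictScalars_injective K
  rw [restrictScalars_top]
  apply h
  · intro x hx
    exact (F⟮t⟯).algebraMap_mem (⟨x, hx⟩ : F)
  · exact mem_adjoin_simple_self F t

/-- A point `(x : y : z)` on a conic through `(1 : 0 : 0)` that generates a nonalgebraic
extension `L / K`: projection from `(1 : 0 : 0)` makes `L` a rational function field over `K`, or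
over an extension of degree at most two if the conic is a cone with this vertex. -/
lemma exists_generator_of_conic_aux (hL : ¬ Algebra.IsAlgebraic K L) {b c d α β : K}
    (hne : b ≠ 0 ∨ c ≠ 0 ∨ d ≠ 0 ∨ α ≠ 0 ∨ β ≠ 0) {x y z : L} (hz : z ≠ 0)
    (hE : ∀ (E : IntermediateField K L) (l : L), l ≠ 0 → l * x ∈ E → l * y ∈ E → l * z ∈ E →
      E = ⊤)
    (h : algebraMap K L b * y ^ 2 + algebraMap K L c * z ^ 2 + algebraMap K L d * (y * z) +
      x * (algebraMap K L α * y + algebraMap K L β * z) = 0) :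
    ∃ F : IntermediateField K L, FiniteDimensional K F ∧ Module.finrank K F ≤ 2 ∧
      ∃ t : L, Transcendental F t ∧ F⟮t⟯ = ⊤ := by
  have hE' (E : IntermediateField K L) (hx : x / z ∈ E) (hy : y / z ∈ E) : E = ⊤ := by
    refine hE E z⁻¹ (inv_ne_zero hz) ?_ ?_ ?_
    · rwa [mul_comm, ← div_eq_mul_inv]
    · rwa [mul_comm, ← div_eq_mul_inv]
    · rw [inv_mul_cancel₀ hz]; exact one_mem E
  have hrel : algebraMap K L b * (y / z) ^ 2 + algebraMap K L d * (y / z) + algebraMap K L c +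
      (x / z) * (algebraMap K L α * (y / z) + algebraMap K L β) = 0 := by
    have hz2 : z ^ 2 ≠ 0 := pow_ne_zero 2 hz
    apply mul_left_cancel₀ hz2
    rw [mul_zero, ← h]
    field_simp
    ring
  have bot (t : L) (ht : ∀ E : IntermediateField K L, t ∈ E → E = ⊤) :
      ∃ F : IntermediateField K L, FiniteDimensional K F ∧ Module.finrank K F ≤ 2 ∧
        ∃ t : L, Transcendental F t ∧ F⟮t⟯ = ⊤ := by
    have htop := adjoin_simple_eq_top_of_mem (F := (⊥ : IntermediateField K L)) (t := t)
      fun E _ h => ht E h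
    exact ⟨⊥, inferInstance, by rw [IntermediateField.finrank_bot]; norm_num, t,
      transcendental_of_adjoin_eq_top_of_not_isAlgebraic hL _ htop, htop⟩
  by_cases hαβ : algebraMap K L α * (y / z) + algebraMap K L β = 0
  · by_cases hα : α = 0
    · have hβ : β = 0 := by simpa [hα] using hαβ
      rw [hαβ, mul_zero, add_zero] at hrel
      -- the cone: `y / z` is a root of `b T² + d T + c`
      have hp : Polynomial.aeval (y / z)
          (Polynomial.C b * Polynomial.X ^ 2 + Polynomial.C d * Polynomial.X +
            Polynomial.C c) = 0 := by
        simpa using hrel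
      have hp0 : (Polynomial.C b * Polynomial.X ^ 2 + Polynomial.C d * Polynomial.X +
            Polynomial.C c) ≠ 0 := by
        intro h0
        have h2 := congrArg (fun p => Polynomial.coeff p 2) h0
        have h1 := congrArg (fun p => Polynomial.coeff p 1) h0
        have h00 := congrArg (fun p => Polynomial.coeff p 0) h0
        simp [Polynomial.coeff_X, Polynomial.coeff_C] at h2 h1 h00
        simp_all
      have hint : IsIntegral K (y / z) := isAlgebraic_iff_isIntegral.1 ⟨_, hp0, hp⟩
      have hfin : FiniteDimensional K K⟮y / z⟯ := adjoin.finiteDimensional hint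
      have htop := adjoin_simple_eq_top_of_mem (F := K⟮y / z⟯) (t := x / z)
        fun E hF h => hE' E h (hF (mem_adjoin_simple_self K _))
      refine ⟨K⟮y / z⟯, hfin, ?_, x / z,
        transcendental_of_adjoin_eq_top_of_not_isAlgebraic hL _ htop, htop⟩
      rw [adjoin.finrank hint]
      refine (Polynomial.natDegree_le_of_dvd (minpoly.dvd K _ hp) hp0).trans ?_
      exact Polynomial.natDegree_quadratic_le
    · have hα' : algebraMap K L α ≠ 0 := (map_ne_zero _).2 hα
      refine bot (x / z) fun E hE => hE' E hE ?_
      have : y / z = algebraMap K L (-β / α) := by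
        rw [map_div₀, map_neg, eq_div_iff hα']
        linear_combination hαβ
      rw [this]
      exact E.algebraMap_mem _
  · refine bot (y / z) fun E hE => hE' E ?_ hE
    have : x / z = -(algebraMap K L b * (y / z) ^ 2 + algebraMap K L d * (y / z) +
        algebraMap K L c) / (algebraMap K L α * (y / z) + algebraMap K L β) := by
      rw [eq_div_iff hαβ]
      linear_combination hrel
    rw [this]
    have ha (r : K) : algebraMap K L r ∈ E := E.algebraMap_mem r
    exact E.div_mem (E.neg_mem (E.add_mem (E.add_mem (E.mul_mem (ha b) (pow_mem hE 2))
      (E.mul_mem (ha d) hE)) (ha c))) (E.add_mem (E.mul_mem (ha α) hE) (ha β))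

/-- The case of `exists_generator_of_ternaryForm` in which the first coordinate of the rational
point does not vanish. -/
lemma exists_generator_of_ternaryForm_aux (hL : ¬ Algebra.IsAlgebraic K L) {a b c d e f : K}
    (hne : ¬ (a = 0 ∧ b = 0 ∧ c = 0 ∧ d = 0 ∧ e = 0 ∧ f = 0)) {p q r : K} (hp : p ≠ 0)
    (hpqr : ternaryForm a b c d e f p q r = 0) {x y z : L}
    (hE : ∀ (E : IntermediateField K L) (l : L), l ≠ 0 → l * x ∈ E → l * y ∈ E → l * z ∈ E →
      E = ⊤)
    (h : ternaryForm (algebraMap K L a) (algebraMap K L b) (algebraMap K L c) (algebraMap K L d)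
      (algebraMap K L e) (algebraMap K L f) x y z = 0) :
    ∃ F : IntermediateField K L, FiniteDimensional K F ∧ Module.finrank K F ≤ 2 ∧
      ∃ t : L, Transcendental F t ∧ F⟮t⟯ = ⊤ := by
  obtain ⟨m, hm⟩ : ∃ m, m = q / p := ⟨_, rfl⟩
  obtain ⟨n, hn⟩ : ∃ n, n = r / p := ⟨_, rfl⟩
  have h0 : a + b * m ^ 2 + c * n ^ 2 + d * (m * n) + e * n + f * m = 0 := by
    have hp2 : p ^ 2 ≠ 0 := pow_ne_zero 2 hp
    apply mul_left_cancel₀ hp2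
    rw [mul_zero, ← hpqr, ternaryForm, hm, hn]
    field_simp
  have h0' := congrArg (algebraMap K L) h0
  have hne' : b ≠ 0 ∨ c ≠ 0 ∨ d ≠ 0 ∨ 2 * b * m + d * n + f ≠ 0 ∨ 2 * c * n + d * m + e ≠ 0 := by
    by_contra! hcon
    obtain ⟨rfl, rfl, rfl, hf, he⟩ := hcon
    have hf' : f = 0 := by simpa using hf
    have he' : e = 0 := by simpa using he
    refine hne ⟨by simpa [hf', he'] using h0, rfl, rfl, rfl, he', hf'⟩
  simp only [map_add, map_mul, map_pow, map_zero] at h0'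
  obtain ⟨Y, hY⟩ : ∃ Y, Y = y - algebraMap K L m * x := ⟨_, rfl⟩
  obtain ⟨Z, hZ⟩ : ∃ Z, Z = z - algebraMap K L n * x := ⟨_, rfl⟩
  have hE' (E : IntermediateField K L) (l : L) (hl : l ≠ 0) (hx : l * x ∈ E) (hy : l * Y ∈ E)
      (hz : l * Z ∈ E) : E = ⊤ := by
    refine hE E l hl hx ?_ ?_
    · have : l * y = l * Y + algebraMap K L m * (l * x) := by rw [hY]; ring
      rw [this]
      exact E.add_mem hy (E.mul_mem (E.algebraMap_mem m) hx)
    · have : l * z = l * Z + algebraMap K L n * (l * x) := by rw [hZ]; ring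
      rw [this]
      exact E.add_mem hz (E.mul_mem (E.algebraMap_mem n) hx)
  have h' : algebraMap K L b * Y ^ 2 + algebraMap K L c * Z ^ 2 + algebraMap K L d * (Y * Z) +
      x * (algebraMap K L (2 * b * m + d * n + f) * Y +
        algebraMap K L (2 * c * n + d * m + e) * Z) = 0 := by
    rw [ternaryForm] at h
    simp only [map_add, map_mul, map_ofNat]
    rw [hY, hZ]
    linear_combination h - x ^ 2 * h0'
  by_cases hZ0 : Z = 0
  · by_cases hY0 : Y = 0
    · exfalso
      -- then `L` is generated by ratios of the coordinates of a rational point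
      have hx : x ≠ 0 := by
        rintro rfl
        apply hL
        have hbot := hE' ⊥ 1 one_ne_zero (by simp) (by simp [hY0]) (by simp [hZ0])
        exact ⟨fun w => by
          obtain ⟨v, rfl⟩ := mem_bot.1 (hbot ▸ mem_top : w ∈ (⊥ : IntermediateField K L))
          exact isAlgebraic_algebraMap v⟩
      apply hL
      have hbot := hE' ⊥ x⁻¹ (inv_ne_zero hx) (by rw [inv_mul_cancel₀ hx]; exact one_mem _)
        (by simp [hY0]) (by simp [hZ0])
      exact ⟨fun w => by
          obtain ⟨v, rfl⟩ := mem_bot.1 (hbot ▸ mem_top : w ∈ (⊥ : IntermediateField K L))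
          exact isAlgebraic_algebraMap v⟩
    · refine exists_generator_of_conic_aux hL (b := c) (c := b) (d := d)
        (α := 2 * c * n + d * m + e) (β := 2 * b * m + d * n + f) (by tauto) hY0
        (x := x) (y := Z) (fun E l hl hx hz hy => hE' E l hl hx hy hz) ?_
      rw [← h']; ring
  · exact exists_generator_of_conic_aux hL hne' hZ0 hE' h'

/-- If `(x : y : z)` is a point of a conic over `K` having a `K`-rational point, and `L` is
generated over `K` by its coordinates and not algebraic over `K`, then `L` is a rational function
field in one variable over an extension of `K` of degree at most two. -/
theorem exists_generator_of_ternaryForm (hL : ¬ Algebra.IsAlgebraic K L) {a b c d e f : K}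
    (hne : ¬ (a = 0 ∧ b = 0 ∧ c = 0 ∧ d = 0 ∧ e = 0 ∧ f = 0)) {p q r : K}
    (hp : p ≠ 0 ∨ q ≠ 0 ∨ r ≠ 0)
    (hpqr : ternaryForm a b c d e f p q r = 0) {x y z : L}
    (hE : ∀ (E : IntermediateField K L) (l : L), l ≠ 0 → l * x ∈ E → l * y ∈ E → l * z ∈ E →
      E = ⊤)
    (h : ternaryForm (algebraMap K L a) (algebraMap K L b) (algebraMap K L c) (algebraMap K L d)
      (algebraMap K L e) (algebraMap K L f) x y z = 0) :
    ∃ F : IntermediateField K L, FiniteDimensional K F ∧ Module.finrank K F ≤ 2 ∧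
      ∃ t : L, Transcendental F t ∧ F⟮t⟯ = ⊤ := by
  rcases hp with hp | hp | hp
  · exact exists_generator_of_ternaryForm_aux hL hne hp hpqr hE h
  · refine exists_generator_of_ternaryForm_aux hL (a := b) (b := a) (c := c) (d := e) (e := d)
      (f := f) (by tauto) hp (q := p) (r := r) ?_ (x := y) (y := x) (z := z)
      (fun E l hl h1 h2 h3 => hE E l hl h2 h1 h3) ?_
    · rw [← hpqr, ternaryForm, ternaryForm]; ring
    · rw [← h, ternaryForm, ternaryForm]; ring
  · refine exists_generator_of_ternaryForm_aux hL (a := c) (b := b) (c := a) (d := f) (e := e)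
      (f := d) (by tauto) hp (q := q) (r := p) ?_ (x := z) (y := y) (z := x)
      (fun E l hl h1 h2 h3 => hE E l hl h3 h2 h1) ?_
    · rw [← hpqr, ternaryForm, ternaryForm]; ring
    · rw [← h, ternaryForm, ternaryForm]; ring

/-- A quadratic form in three variables is a combination of the six monomials. -/
lemma MvPolynomial.IsHomogeneous.exists_ternaryForm {q : MvPolynomial (Fin 3) K}
    (hq : q.IsHomogeneous 2) : ∃ a b c d e f : K,
      q = ternaryForm (C a) (C b) (C c) (C d) (C e) (C f) (X 0) (X 1) (X 2) := by
  classical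
  have hmon (v : Fin 3 →₀ ℕ) (r : K) (hv : v.degree = 2) : ∃ a b c d e f : K, monomial v r =
      ternaryForm (C a) (C b) (C c) (C d) (C e) (C f) (X 0) (X 1) (X 2) := by
    have hm : monomial v r = C r * (X 0 ^ v 0 * X 1 ^ v 1 * X 2 ^ v 2) := by
      rw [monomial_eq, Finsupp.prod_fintype _ _ (by simp), Fin.prod_univ_three]
    have hsum : v 0 + v 1 + v 2 = 2 := by
      rw [Finsupp.degree_eq_sum, Fin.sum_univ_three] at hv
      exact hv
    rw [hm]
    have h0 : v 0 ≤ 2 := by omega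
    have h1 : v 1 ≤ 2 := by omega
    obtain h | h | h | h | h | h : (v 0 = 2 ∧ v 1 = 0 ∧ v 2 = 0) ∨ (v 0 = 0 ∧ v 1 = 2 ∧ v 2 = 0) ∨
        (v 0 = 0 ∧ v 1 = 0 ∧ v 2 = 2) ∨ (v 0 = 0 ∧ v 1 = 1 ∧ v 2 = 1) ∨
        (v 0 = 1 ∧ v 1 = 0 ∧ v 2 = 1) ∨ (v 0 = 1 ∧ v 1 = 1 ∧ v 2 = 0) := by omega
    · exact ⟨r, 0, 0, 0, 0, 0, by simp [h, ternaryForm]⟩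
    · exact ⟨0, r, 0, 0, 0, 0, by simp [h, ternaryForm]⟩
    · exact ⟨0, 0, r, 0, 0, 0, by simp [h, ternaryForm]⟩
    · exact ⟨0, 0, 0, r, 0, 0, by simp [h, ternaryForm]⟩
    · exact ⟨0, 0, 0, 0, r, 0, by simp [h, ternaryForm]⟩
    · exact ⟨0, 0, 0, 0, 0, r, by simp [h, ternaryForm]⟩
  rw [q.as_sum]
  refine Finset.sum_induction _ (fun g : MvPolynomial (Fin 3) K => ∃ a b c d e f : K, g =
    ternaryForm (C a) (C b) (C c) (C d) (C e) (C f) (X 0) (X 1) (X 2)) ?_ ?_ ?_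
  · rintro _ _ ⟨a, b, c, d, e, f, rfl⟩ ⟨a', b', c', d', e', f', rfl⟩
    exact ⟨a + a', b + b', c + c', d + d', e + e', f + f', by
      simp only [ternaryForm, C_add]; ring⟩
  · exact ⟨0, 0, 0, 0, 0, 0, by simp [ternaryForm]⟩
  · intro v hv
    refine hmon v _ ?_
    have := hq (mem_support_iff.1 hv)
    rw [Finsupp.degree_eq_weight_one]
    exact this

/-- The generic point of a conic is not algebraic: if all forms vanishing at a point `u` of the
conic `q = 0` with `u i = 1` are divisible by `q` up to a power of `X i`, then the coordinates of
`u` generate a nonalgebraic extension. -/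
lemma not_isAlgebraic_of_conic {q : MvPolynomial (Fin 3) K} (hq : q.IsHomogeneous 2)
    (hq0 : q ≠ 0) {u : Fin 3 → L} {i : Fin 3} (hi : u i = 1) (hu : aeval u q = 0)
    (hdvd : ∀ (n : ℕ) (f : MvPolynomial (Fin 3) K), f.IsHomogeneous n → aeval u f = 0 →
      ∃ m, q ∣ X i ^ m * f) : ¬ Algebra.IsAlgebraic K L := by
  classical
  intro hL
  have key (j l : Fin 3) (hji : j ≠ i) (hli : l ≠ i) (hlj : l ≠ j) : degreeOf l q = 0 := by
    have hp0 : minpoly K (u j) ≠ 0 := minpoly.ne_zero (hL.isAlgebraic (u j)).isIntegral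
    obtain ⟨p, hp⟩ : ∃ p, p = minpoly K (u j) := ⟨_, rfl⟩
    rw [← hp] at hp0
    -- the homogenization of `p` in the variables `X j`, `X i`
    obtain ⟨f, hf⟩ : ∃ f : MvPolynomial (Fin 3) K, f = ∑ n ∈ Finset.range (p.natDegree + 1),
      C (p.coeff n) * X j ^ n * X i ^ (p.natDegree - n) := ⟨_, rfl⟩
    have hfh : f.IsHomogeneous p.natDegree := by
      rw [hf]
      refine IsHomogeneous.sum _ _ _ fun n hn => ?_
      have h1 := ((isHomogeneous_C (Fin 3) (p.coeff n)).mul (isHomogeneous_X_pow (R := K) j n)).mul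
        (isHomogeneous_X_pow (R := K) i (p.natDegree - n))
      convert h1 using 1
      have := Finset.mem_range.1 hn
      omega
    have hfu : aeval u f = 0 := by
      have : Polynomial.aeval (u j) p = 0 := by rw [hp]; exact minpoly.aeval _ _
      rw [← this, hf, Polynomial.aeval_eq_sum_range]
      simp [hi, Algebra.smul_def]
    have hf0 : f ≠ 0 := by
      -- setting `X i = 1` and `X j = T` recovers `p`
      intro h0
      have h2 : aeval (fun m => if m = i then 1 else (Polynomial.X : Polynomial K)) f = p := by
        conv_rhs => rw [p.as_sum_range_C_mul_X_pow]
        rw [hf]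
        simp [hji]
      rw [h0, map_zero] at h2
      exact hp0 h2.symm
    obtain ⟨m, g, hg⟩ := hdvd _ f hfh hfu
    have hne : X i ^ m * f ≠ 0 := mul_ne_zero (pow_ne_zero _ (X_ne_zero i)) hf0
    have hg0 : g ≠ 0 := by rintro rfl; rw [mul_zero] at hg; exact hne hg
    have h1 : degreeOf l (X i ^ m * f) = 0 := by
      refine Nat.le_zero.1 ((degreeOf_mul_le _ _ _).trans ?_)
      have h2 : degreeOf l (X i ^ m : MvPolynomial (Fin 3) K) = 0 := by
        refine Nat.le_zero.1 ((degreeOf_pow_le _ _ _).trans ?_)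
        rw [degreeOf_X_of_ne hli, mul_zero]
      rw [h2, zero_add, hf]
      refine (degreeOf_sum_le _ _ _).trans (Finset.sup_le fun n _ => ?_)
      refine (degreeOf_mul_le _ _ _).trans ?_
      have h3 : degreeOf l (X i ^ (p.natDegree - n) : MvPolynomial (Fin 3) K) ≤ 0 := by
        refine (degreeOf_pow_le _ _ _).trans ?_
        rw [degreeOf_X_of_ne hli, mul_zero]
      have h4 : degreeOf l (X j ^ n : MvPolynomial (Fin 3) K) ≤ 0 := by
        refine (degreeOf_pow_le _ _ _).trans ?_
        rw [degreeOf_X_of_ne hlj, mul_zero]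
      have h5 := degreeOf_C_mul_le (X j ^ n : MvPolynomial (Fin 3) K) l (p.coeff n)
      omega
    rw [hg, degreeOf_mul_eq hq0 hg0] at h1
    omega
  have third : ∀ i l : Fin 3, l ≠ i → ∃ j, j ≠ i ∧ l ≠ j := by decide
  -- so `q` only involves `X i`, and `q(u) = 0` forces `q = 0`
  have hcoeff (v : Fin 3 →₀ ℕ) (hv : coeff v q ≠ 0) : v = Finsupp.single i 2 := by
    have hl (l : Fin 3) (hl : l ≠ i) : v l = 0 := by
      obtain ⟨j, hj, hlj⟩ := third i l hl
      exact Nat.le_zero.1 (key j l hj hl hlj ▸ monomial_le_degreeOf l (mem_support_iff.2 hv))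
    have h1 : v = Finsupp.single i (v i) := by
      ext l
      rcases eq_or_ne l i with rfl | h
      · simp
      · rw [hl l h, Finsupp.single_eq_of_ne h]
    have h2 : v.degree = 2 := by
      rw [Finsupp.degree_eq_weight_one]
      exact hq hv
    rw [h1, Finsupp.degree_single] at h2
    rw [h1, h2]
  have hqm : q = monomial (Finsupp.single i 2) (coeff (Finsupp.single i 2) q) := by
    ext v
    rw [coeff_monomial]
    split_ifs with h
    · rw [h]
    · by_contra hv
      exact h (hcoeff v hv).symm
  apply hq0
  rw [hqm, aeval_monomial] at hu
  rw [hqm]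
  simpa [hi] using hu

open IntermediateField in
/-- The function field of a conic over `K = k(s)` is a rational function field over an extension
of `K` of degree at most two. -/
theorem exists_generator_of_conic {k : Type*} [Field k] [IsAlgClosed k] [CharZero K] [Algebra k K]
    {s : K} (hs : k⟮s⟯ = ⊤) {q : MvPolynomial (Fin 3) K} (hq : q.IsHomogeneous 2)
    (hq0 : q ≠ 0) {u : Fin 3 → L} {i : Fin 3} (hi : u i = 1) (hu : aeval u q = 0)
    (htop : IntermediateField.adjoin K (Set.range u) = ⊤)
    (hdvd : ∀ (n : ℕ) (f : MvPolynomial (Fin 3) K), f.IsHomogeneous n → aeval u f = 0 →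
      ∃ m, q ∣ X i ^ m * f) :
    ∃ F : IntermediateField K L, FiniteDimensional K F ∧ Module.finrank K F ≤ 2 ∧
      ∃ t : L, Transcendental F t ∧ F⟮t⟯ = ⊤ := by
  have hL := not_isAlgebraic_of_conic hq hq0 hi hu hdvd
  obtain ⟨a, b, c, d, e, f, rfl⟩ := hq.exists_ternaryForm
  obtain ⟨x, y, z, hne, h⟩ := exists_isotropic hs a b c d e f
  refine exists_generator_of_ternaryForm hL ?_ hne h (x := u 0) (y := u 1) (z := u 2) ?_ ?_
  · rintro ⟨rfl, rfl, rfl, rfl, rfl, rfl⟩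
    exact hq0 (by simp [ternaryForm])
  · intro E l hl h0 h1 h2
    have hall : ∀ j, l * u j ∈ E := by
      intro j
      fin_cases j
      exacts [h0, h1, h2]
    have hlE : l ∈ E := by simpa [hi] using hall i
    rw [eq_top_iff, ← htop, adjoin_le_iff]
    rintro _ ⟨j, rfl⟩
    have := E.mul_mem (E.inv_mem hlE) (hall j)
    rwa [inv_mul_cancel_left₀ hl] at this
  · rw [← hu]
    simp [ternaryForm]

end Conic

/-! ### Finite groups acting on the function field of a conic bundle -/

section Core

open IntermediateField

/-- The constant field of `F(t)` is `F`. -/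
lemma mem_range_of_isAlgebraic_of_adjoin {F L : Type*} [Field F] [Field L] [Algebra F L] {t : L}
    (ht : Transcendental F t) (htop : F⟮t⟯ = ⊤) {x : L} (hx : IsAlgebraic F x) :
    ∃ c : F, algebraMap F L c = x := by
  let e : RatFunc F ≃ₐ[F] L :=
    (RatFunc.algEquivOfTranscendental t ht).trans ((equivOfEq htop).trans topEquiv)
  by_contra! hc
  refine RatFunc.transcendental_of_ne_C (e.symm x) ?_ (hx.algHom (e.symm : L →ₐ[F] RatFunc F))
  rintro ⟨c, h⟩
  refine hc c ?_
  have h2 := congrArg e h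
  rw [AlgEquiv.apply_symm_apply, ← RatFunc.algebraMap_eq_C, e.commutes] at h2
  exact h2.symm

/-- An action on `L` preserving the image of `E` restricts to an action on `E`. -/
lemma exists_hom_restrict {k E L G : Type*} [Field k] [Field E] [Field L] [Algebra k E]
    [Algebra k L] [Algebra E L] [IsScalarTower k E L] [Group G] (γ : G →* (L ≃ₐ[k] L))
    (h : ∀ g (x : E), ∃ y : E, γ g (algebraMap E L x) = algebraMap E L y) :
    ∃ σ : G →* (E ≃ₐ[k] E), ∀ g x, γ g (algebraMap E L x) = algebraMap E L (σ g x) := by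
  choose f hf using h
  have inj := (algebraMap E L).injective
  let F (g : G) : E →ₐ[k] E :=
    { toFun := f g
      map_one' := inj (by rw [← hf]; simp)
      map_mul' := fun x y => inj (by rw [← hf]; simp [hf])
      map_zero' := inj (by rw [← hf]; simp)
      map_add' := fun x y => inj (by rw [← hf]; simp [hf])
      commutes' := fun r => inj (by
        rw [← hf, ← IsScalarTower.algebraMap_apply, AlgEquiv.commutes]) }
  have hmul (g g' : G) (x : E) : f (g * g') x = f g (f g' x) := inj (by
    rw [← hf, ← hf, ← hf, map_mul, AlgEquiv.mul_apply])
  have hone (x : E) : f 1 x = x := inj (by rw [← hf, map_one, AlgEquiv.one_apply])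
  let σ : G →* (E ≃ₐ[k] E) :=
    { toFun := fun g => AlgEquiv.ofAlgHom (F g) (F g⁻¹)
        (AlgHom.ext fun x => ((hmul g g⁻¹ x).symm.trans (by rw [mul_inv_cancel, hone]) : _ = x))
        (AlgHom.ext fun x => ((hmul g⁻¹ g x).symm.trans (by rw [inv_mul_cancel, hone]) : _ = x))
      map_one' := AlgEquiv.ext hone
      map_mul' := fun g g' => AlgEquiv.ext (hmul g g') }
  exact ⟨σ, hf⟩

/-- A finite group of automorphisms of `L ⊇ K = k(s)` preserving `K`, where `L` is a rational
function field over a finite extension `F` of `K` of degree at most two, has a normal abelian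
subgroup of index at most `7200`. The field `F` is preserved as well, being the algebraic closure
of `K` in `L`; the kernel `N` of the action on `F` is a finite group of Möbius transformations,
the kernel `M` of the action on `K` contains `N` with index at most two, and the quotient by `M`
is again a finite group of Möbius transformations. -/
theorem exists_abelian_index_le {k K L : Type*} [Field k] [IsAlgClosed k] [CharZero k] [Field K]
    [Algebra k K] [Field L] [Algebra k L] [Algebra K L] [IsScalarTower k K L] {s : K}
    (hs : k⟮s⟯ = ⊤) (F : IntermediateField K L) [FiniteDimensional K F]
    (hF : Module.finrank K F ≤ 2) {t : L} (ht : Transcendental F t) (htop : F⟮t⟯ = ⊤)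
    {G : Type*} [Group G] [Finite G] (γ : G →* (L ≃ₐ[k] L)) (hγ : Function.Injective γ)
    (hK : ∀ g (x : K), ∃ y : K, γ g (algebraMap K L x) = algebraMap K L y) :
    ∃ A : Subgroup G, A.Normal ∧ IsMulCommutative A ∧ A.index ≤ 7200 := by
  obtain ⟨σ, hσ⟩ := exists_hom_restrict γ hK
  have hFG (g : G) (x : F) : ∃ y : F, γ g (algebraMap F L x) = algebraMap F L y := by
    obtain ⟨p, hp0, hp⟩ := Algebra.IsAlgebraic.isAlgebraic (R := K) x
    have hp' : Polynomial.aeval (algebraMap F L x) p = 0 := by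
      rw [Polynomial.aeval_algebraMap_apply, hp, map_zero]
    have halg : IsAlgebraic K (γ g (algebraMap F L x)) := by
      refine ⟨p.map (σ g : K →+* K), (Polynomial.map_ne_zero_iff (σ g).injective).2 hp0, ?_⟩
      have h1 := congrArg (γ g) hp'
      rw [map_zero, Polynomial.aeval_def] at h1
      rw [← h1, Polynomial.aeval_def, Polynomial.eval₂_map]
      change _ = (γ g : L →+* L) _
      rw [Polynomial.hom_eval₂]
      congr 1
      ext y
      exact (hσ g y).symm
    obtain ⟨c, hc⟩ := mem_range_of_isAlgebraic_of_adjoin ht htop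
      (halg.tower_top F : IsAlgebraic F _)
    exact ⟨c, hc.symm⟩
  have : IsScalarTower k F L := ⟨fun r x y => by
    change ((r • x : F) : L) * y = r • ((x : L) * y)
    rw [IntermediateField.coe_smul, smul_mul_assoc]⟩
  obtain ⟨τ, hτ⟩ := exists_hom_restrict γ hFG
  have : CharZero K := charZero_of_injective_algebraMap (algebraMap k K).injective
  have : CharZero F := charZero_of_injective_algebraMap (algebraMap K F).injective
  have hN : FibreType τ.ker := fibreType_ker ht htop γ hγ τ hτ
  have hτσ (g : G) (x : K) : τ g (algebraMap K F x) = algebraMap K F (σ g x) :=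
    (algebraMap F L).injective (by
      rw [← hτ, ← IsScalarTower.algebraMap_apply, hσ, ← IsScalarTower.algebraMap_apply])
  have hNM : τ.ker ≤ σ.ker := by
    intro g hg
    rw [MonoidHom.mem_ker] at hg ⊢
    ext x
    apply (algebraMap K F).injective
    rw [← hτσ, hg]
    rfl
  have hrel : τ.ker.relIndex σ.ker ≤ 2 := by
    -- `σ.ker / τ.ker` embeds into the group of automorphisms of `F` over `K`
    let ρ : σ.ker →* (F ≃ₐ[K] F) :=
      { toFun := fun g => AlgEquiv.ofRingEquiv (f := (τ g : F ≃+* F)) fun x => by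
          have h1 : σ g = 1 := g.2
          have := hτσ g x
          rwa [h1] at this
        map_one' := by ext x; simp
        map_mul' := fun g h => by
          refine AlgEquiv.ext fun x => ?_
          change τ (g * h : σ.ker) x = τ g (τ h x)
          rw [Subgroup.coe_mul, map_mul, AlgEquiv.mul_apply] }
    have hρ : τ.ker.subgroupOf σ.ker = ρ.ker := by
      ext g
      rw [Subgroup.mem_subgroupOf, MonoidHom.mem_ker, MonoidHom.mem_ker, AlgEquiv.ext_iff,
        AlgEquiv.ext_iff]
      rfl
    rw [Subgroup.relIndex, hρ, Subgroup.index_ker]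
    refine (Nat.card_le_card_of_injective (Subtype.val : ρ.range → (F ≃ₐ[K] F))
      Subtype.val_injective).trans (le_trans ?_ hF)
    rw [Nat.card_eq_fintype_card]
    exact AlgEquiv.card_le
  have : Finite σ.range := Finite.of_surjective _ σ.rangeRestrict_surjective
  rcases card_le_or_exists_isCyclic hs (Subgroup.subtype σ.range) Subtype.val_injective with h | h
  · refine exists_abelian_index_le_of_small_base hNM hrel hN ?_
    rwa [Subgroup.index_ker]
  · obtain ⟨C, hC, hcyc⟩ := h
    let P := C.comap σ.rangeRestrict
    have hP : P.index ≤ 2 := by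
      rwa [Subgroup.index_comap_of_surjective _ σ.rangeRestrict_surjective]
    let f : P →* C := (σ.rangeRestrict.comp P.subtype).codRestrict C fun x => x.2
    refine exists_abelian_index_le_of_cyclic_base hNM hrel hN hP f fun x => ?_
    rw [MonoidHom.mem_ker, Subtype.ext_iff, Subtype.ext_iff]
    rfl

end Core

/-! ### Points of projective schemes -/

section ProjPoints

open HomogeneousLocalization

lemma MvPolynomial.IsHomogeneous.eval₂_mul {R S σ : Type*} [CommRing R] [CommRing S] [Fintype σ]
    {P : MvPolynomial σ R} {n : ℕ} (hP : P.IsHomogeneous n) (f : R →+* S) (c : S) (v : σ → S) :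
    P.eval₂ f (fun j => c * v j) = c ^ n * P.eval₂ f v := by
  rw [eval₂_eq', eval₂_eq', Finset.mul_sum]
  refine Finset.sum_congr rfl fun d hd => ?_
  have hd' : ∑ i, d i = n := by
    rw [← Finsupp.degree_eq_sum, Finsupp.degree_eq_weight_one]
    exact hP (mem_support_iff.1 hd)
  rw [Finset.prod_congr rfl fun i _ => mul_pow c (v i) (d i), Finset.prod_mul_distrib,
    Finset.prod_pow_eq_pow_sum, hd']
  ring

variable {K A : Type u} [Field K] [CommRing A] [Algebra K A] (𝒜 : ℕ → Submodule K A)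
  [GradedAlgebra 𝒜] {σ : Type*} {x : σ → A} (hx : ∀ i, x i ∈ 𝒜 1)

/-- The coordinate `x j / x i` on the standard chart `x i ≠ 0` of `Proj 𝒜`. -/
noncomputable def chartCoord (i j : σ) : Away 𝒜 (x i) :=
  Away.mk 𝒜 (hx i) 1 (x j) (by simpa using hx j)

lemma chartCoord_self (i : σ) : chartCoord 𝒜 hx i i = 1 := by
  apply val_injective
  rw [chartCoord, Away.val_mk, val_one]
  simp only [pow_one]
  exact Localization.mk_self (⟨x i, _⟩ : Submonoid.powers (x i))

variable [Fintype σ]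

include hx in
lemma aeval_mem_of_isHomogeneous {P : MvPolynomial σ K} {n : ℕ} (hP : P.IsHomogeneous n) :
    MvPolynomial.aeval x P ∈ 𝒜 n := by
  rw [MvPolynomial.aeval_def, MvPolynomial.eval₂_eq']
  refine Submodule.sum_mem _ fun d hd => ?_
  rw [← Algebra.smul_def]
  refine Submodule.smul_mem _ _ ?_
  have hd' : ∑ i, d i = n := by
    rw [← Finsupp.degree_eq_sum, Finsupp.degree_eq_weight_one]
    exact hP (MvPolynomial.mem_support_iff.1 hd)
  rw [← hd']
  simpa using SetLike.prod_mem_graded 𝒜 (fun i => d i • 1) (fun i => x i ^ d i)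
    (F := Finset.univ) fun i _ => SetLike.pow_mem_graded (d i) (hx i)

/-- A form of degree `n`, divided by `x i ^ n`, is the same polynomial in the coordinates of
the chart. -/
lemma away_mk_eq_eval₂ (i : σ) {P : MvPolynomial σ K} {n : ℕ} (hP : P.IsHomogeneous n)
    (h : MvPolynomial.aeval x P ∈ 𝒜 (n • 1)) :
    Away.mk 𝒜 (hx i) n (MvPolynomial.aeval x P) h =
      P.eval₂ ((fromZeroRingHom 𝒜 (.powers (x i))).comp (algebraMap K (𝒜 0)))
        (chartCoord 𝒜 hx i) := by
  apply val_injective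
  let c : Localization (Submonoid.powers (x i)) := Localization.mk 1 ⟨x i, ⟨1, pow_one _⟩⟩
  have hmk (n : ℕ) (a : A) (h) : (Away.mk 𝒜 (hx i) n a h).val =
      c ^ n * algebraMap A (Localization (Submonoid.powers (x i))) a := by
    rw [Away.val_mk, Localization.mk_pow, ← Localization.mk_one_eq_algebraMap,
      Localization.mk_mul, one_pow, one_mul, mul_one]
    congr 1
  rw [hmk]
  change _ = algebraMap (Away 𝒜 (x i)) (Localization (Submonoid.powers (x i))) _
  rw [MvPolynomial.hom_eval₂]
  have hcoord : (fun j => algebraMap (Away 𝒜 (x i)) (Localization (Submonoid.powers (x i)))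
      (chartCoord 𝒜 hx i j)) = fun j => c * algebraMap A _ (x j) := by
    funext j
    change (chartCoord 𝒜 hx i j).val = _
    rw [chartCoord, hmk, pow_one]
  rw [hcoord, hP.eval₂_mul]
  congr 1
  rw [MvPolynomial.aeval_def, MvPolynomial.hom_eval₂]
  rfl

/-- A point of `Proj 𝒜` with values in a field lies in a standard chart. -/
lemma exists_chart_lift (hsurj : ∀ n, ∀ a ∈ 𝒜 n, ∃ P : MvPolynomial σ K,
      P.IsHomogeneous n ∧ MvPolynomial.aeval x P = a) {L : Type u} [Field L]
    (m : Spec (.of L) ⟶ Proj 𝒜) : ∃ (i : σ) (θ : Away 𝒜 (x i) →+* L),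
      Spec.map (CommRingCat.ofHom θ) ≫ Proj.awayι 𝒜 (x i) (hx i) one_pos = m := by
  have hadj : Algebra.adjoin (𝒜 0) (Set.range x) = ⊤ := by
    rw [eq_top_iff]
    rintro a -
    induction a using DirectSum.Decomposition.inductionOn 𝒜 with
    | zero => exact zero_mem _
    | homogeneous a =>
      obtain ⟨P, -, hP⟩ := hsurj _ a.1 a.2
      rw [← hP, MvPolynomial.aeval_def, MvPolynomial.eval₂_eq']
      refine sum_mem fun d _ => mul_mem ?_ (prod_mem fun i _ =>
        pow_mem (Algebra.subset_adjoin (Set.mem_range_self i)) _)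
      exact (Algebra.adjoin (𝒜 0) (Set.range x)).algebraMap_mem (algebraMap K (𝒜 0) _)
    | add a b ha hb => exact add_mem ha hb
  have hcover := Proj.iSup_basicOpen_eq_top' 𝒜 x (fun i => ⟨1, hx i⟩) hadj
  obtain ⟨i, hi⟩ := TopologicalSpace.Opens.mem_iSup.1
    (hcover ▸ TopologicalSpace.Opens.mem_top (m default))
  have hrange : Set.range m ⊆ Set.range (Proj.awayι 𝒜 (x i) (hx i) one_pos) := by
    rintro _ ⟨p, rfl⟩
    rw [Subsingleton.elim p default]
    rwa [← Proj.opensRange_awayι 𝒜 (x i) (hx i) one_pos] at hi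
  refine ⟨i, (Spec.preimage (IsOpenImmersion.lift _ m hrange)).hom, ?_⟩
  rw [CommRingCat.ofHom_hom, Spec.map_preimage, IsOpenImmersion.lift_fac]

include hx in
/-- Homogeneous coordinates of a point of `Proj 𝒜 ⊆ ℙ(σ)` with values in a field `L`, given by a
preimmersion `m`: a family `u` normalized by `u i = 1` for some `i`, that generates `L`, at which
every form vanishing on `Proj 𝒜` vanishes. If `m` is dominant and `Proj 𝒜` is reduced, then,
conversely, every form vanishing at `u` vanishes on the chart `x i ≠ 0` of `Proj 𝒜`. -/
theorem exists_homogeneous_coordinates (hsurj : ∀ n, ∀ a ∈ 𝒜 n, ∃ P : MvPolynomial σ K,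
      P.IsHomogeneous n ∧ MvPolynomial.aeval x P = a) {L : Type u} [Field L] [Algebra K L]
    (m : Spec (.of L) ⟶ Proj 𝒜) [IsPreimmersion m]
    (hm : m ≫ Proj.toSpecZero 𝒜 ≫ Spec.map (CommRingCat.ofHom (algebraMap K (𝒜 0))) =
      Spec.map (CommRingCat.ofHom (algebraMap K L))) :
    ∃ (u : σ → L) (i : σ), u i = 1 ∧ IntermediateField.adjoin K (Set.range u) = ⊤ ∧
      (∀ (n : ℕ) (P : MvPolynomial σ K), P.IsHomogeneous n → MvPolynomial.aeval x P = 0 →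
        MvPolynomial.aeval u P = 0) ∧
      (IsReduced (Proj 𝒜) → IsDominant m →
        ∀ (n : ℕ) (P : MvPolynomial σ K), P.IsHomogeneous n → MvPolynomial.aeval u P = 0 →
          ∃ l, MvPolynomial.aeval x (MvPolynomial.X i ^ l * P) = 0) := by
  obtain ⟨i, θ, hθ⟩ := exists_chart_lift 𝒜 hx hsurj m
  have hK : (θ.comp (fromZeroRingHom 𝒜 (.powers (x i)))).comp (algebraMap K (𝒜 0)) =
      algebraMap K L := by
    rw [← hθ, Category.assoc, Proj.awayι_toSpecZero_assoc, ← Spec.map_comp, ← Spec.map_comp] at hm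
    exact congrArg CommRingCat.Hom.hom (Spec.map_injective hm)
  have hθP {n : ℕ} {P : MvPolynomial σ K} (hP : P.IsHomogeneous n)
      (h : MvPolynomial.aeval x P ∈ 𝒜 (n • 1)) :
      θ (Away.mk 𝒜 (hx i) n (MvPolynomial.aeval x P) h) =
        MvPolynomial.aeval (fun j => θ (chartCoord 𝒜 hx i j)) P := by
    rw [away_mk_eq_eval₂ 𝒜 hx i hP, MvPolynomial.hom_eval₂, ← RingHom.comp_assoc, hK]
    rfl
  have hmem {n : ℕ} {P : MvPolynomial σ K} (hP : P.IsHomogeneous n) :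
      MvPolynomial.aeval x P ∈ 𝒜 (n • 1) := by
    rw [smul_eq_mul, mul_one]
    exact aeval_mem_of_isHomogeneous 𝒜 hx hP
  refine ⟨fun j => θ (chartCoord 𝒜 hx i j), i, ?_, ?_, ?_, ?_⟩
  · change θ (chartCoord 𝒜 hx i i) = 1
    rw [chartCoord_self, map_one]
  · have hpre : IsPreimmersion (Spec.map (CommRingCat.ofHom θ)) := by
      have : IsPreimmersion (Spec.map (CommRingCat.ofHom θ) ≫
          Proj.awayι 𝒜 (x i) (hx i) one_pos) := by rw [hθ]; infer_instance
      exact IsPreimmersion.of_comp _ (Proj.awayι 𝒜 (x i) (hx i) one_pos)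
    have hst : θ.SurjectiveOnStalks := ((IsPreimmersion.SpecMap_iff _).1 hpre).2
    have hin (a : Away 𝒜 (x i)) : θ a ∈ IntermediateField.adjoin K
        (Set.range fun j => θ (chartCoord 𝒜 hx i j)) := by
      obtain ⟨n, a, ha, rfl⟩ := Away.mk_surjective 𝒜 (hx i) a
      obtain ⟨P, hP, rfl⟩ := hsurj n a (by simpa using ha)
      rw [hθP hP, MvPolynomial.aeval_def, MvPolynomial.eval₂_eq']
      exact sum_mem fun d _ => mul_mem (IntermediateField.algebraMap_mem _ _) (prod_mem fun j _ =>
        pow_mem (IntermediateField.subset_adjoin _ _ (Set.mem_range_self j)) _)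
    rw [eq_top_iff]
    rintro l -
    obtain ⟨a, b, c, hc, hb, h⟩ := RingHom.surjectiveOnStalks_iff_forall_ideal.1 hst ⊥
      bot_ne_top l
    rw [Ideal.mem_bot] at hc hb
    have hl : l = θ a / θ b := by
      rw [eq_div_iff hb]
      apply mul_left_cancel₀ hc
      rw [← h]; ring
    rw [hl]
    exact div_mem (hin a) (hin b)
  · intro n P hP h0
    rw [← hθP hP (hmem hP)]
    have : Away.mk 𝒜 (hx i) n (MvPolynomial.aeval x P) (hmem hP) = 0 := by
      apply val_injective
      rw [Away.val_mk, val_zero, h0, Localization.mk_zero]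
    rw [this, map_zero]
  · intro hred hdom n P hP h0
    have hdom' : IsDominant (Spec.map (CommRingCat.ofHom θ)) := by
      have : IsDominant (Spec.map (CommRingCat.ofHom θ) ≫
          Proj.awayι 𝒜 (x i) (hx i) one_pos) := by rw [hθ]; exact hdom
      exact IsDominant.of_comp_of_isOpenImmersion _ (Proj.awayι 𝒜 (x i) (hx i) one_pos)
    have hred' : _root_.IsReduced (Away 𝒜 (x i)) := by
      have := isReduced_of_isOpenImmersion (Proj.awayι 𝒜 (x i) (hx i) one_pos)
      exact (affine_isReduced_iff _).1 this
    have hker := (PrimeSpectrum.denseRange_comap_iff_ker_le_nilRadical θ).1 hdom'.denseRange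
    have hzero : Away.mk 𝒜 (hx i) n (MvPolynomial.aeval x P) (hmem hP) = 0 := by
      have := hker (x := Away.mk 𝒜 (hx i) n (MvPolynomial.aeval x P) (hmem hP))
        (by rw [RingHom.mem_ker, hθP hP]; exact h0)
      exact (mem_nilradical.1 this).eq_zero
    have hval := congrArg val hzero
    rw [Away.val_mk, val_zero, Localization.mk_eq_mk', IsLocalization.mk'_eq_zero_iff] at hval
    obtain ⟨⟨_, l, rfl⟩, hl⟩ := hval
    refine ⟨l, ?_⟩
    rw [map_mul, map_pow, MvPolynomial.aeval_X]
    exact hl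

end ProjPoints

section Coordinates

attribute [local instance] MvPolynomial.gradedAlgebra

open IntermediateField

variable {K L : Type u} [Field K] [Field L] [Algebra K L]

/-- The residue fields of the projective line are generated by one element. -/
lemma exists_adjoin_eq_top_of_projectiveLine (m : Spec (.of L) ⟶ (projectiveLine K).left)
    [IsPreimmersion m]
    (hm : m ≫ (projectiveLine K).hom = Spec.map (CommRingCat.ofHom (algebraMap K L))) :
    ∃ s : L, K⟮s⟯ = ⊤ := by
  have : IsPreimmersion (Y := Proj (MvPolynomial.homogeneousSubmodule (Fin 2) K)) m :=
    ‹IsPreimmersion m›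
  obtain ⟨u, i, hi, htop, -⟩ := exists_homogeneous_coordinates
    (MvPolynomial.homogeneousSubmodule (Fin 2) K) (x := MvPolynomial.X)
    (fun i => MvPolynomial.isHomogeneous_X K i) (fun n a ha => ⟨a, ha, by simp⟩) m hm
  obtain ⟨j, hj⟩ : ∃ j : Fin 2, ∀ l, l = i ∨ l = j :=
    ⟨1 - i, by clear hi htop; revert i; decide⟩
  refine ⟨u j, ?_⟩
  rw [eq_top_iff, ← htop, adjoin_le_iff]
  rintro _ ⟨l, rfl⟩
  rcases hj l with rfl | rfl
  · rw [hi]; exact one_mem _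
  · exact mem_adjoin_simple_self K _

/-- Homogeneous coordinates of the generic point of a reduced plane conic `q = 0`. -/
lemma exists_coordinates_of_planeConic (q : MvPolynomial.homogeneousSubmodule (Fin 3) K 2)
    [IsReduced (planeConic q).left] (m : Spec (.of L) ⟶ (planeConic q).left)
    [IsPreimmersion m] [IsDominant m]
    (hm : m ≫ (planeConic q).hom = Spec.map (CommRingCat.ofHom (algebraMap K L))) :
    ∃ (u : Fin 3 → L) (i : Fin 3), u i = 1 ∧
      IntermediateField.adjoin K (Set.range u) = ⊤ ∧ MvPolynomial.aeval u q.1 = 0 ∧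
      ∀ (n : ℕ) (f : MvPolynomial (Fin 3) K), f.IsHomogeneous n → MvPolynomial.aeval u f = 0 →
        ∃ l, q.1 ∣ MvPolynomial.X i ^ l * f := by
  let _ := quotientGradedAlgebra (MvPolynomial.homogeneousSubmodule (Fin 3) K)
    (Ideal.span {(q : MvPolynomial (Fin 3) K)})
    (Ideal.homogeneous_span _ _ (by rintro _ rfl; exact ⟨2, q.2⟩))
  have hmk (P : MvPolynomial (Fin 3) K) : MvPolynomial.aeval
      (fun i => Ideal.Quotient.mk (Ideal.span {(q : MvPolynomial (Fin 3) K)})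
        (MvPolynomial.X i)) P = Ideal.Quotient.mkₐ K (Ideal.span {q.1}) P := by
    rw [MvPolynomial.aeval_unique (Ideal.Quotient.mkₐ K (Ideal.span {q.1}))]
    rfl
  have : IsPreimmersion (Y := Proj (quotientGrading (MvPolynomial.homogeneousSubmodule (Fin 3) K)
      (Ideal.span {(q : MvPolynomial (Fin 3) K)}))) m := ‹IsPreimmersion m›
  obtain ⟨u, i, hi, htop, h1, h2⟩ := exists_homogeneous_coordinates
    (quotientGrading (MvPolynomial.homogeneousSubmodule (Fin 3) K)
      (Ideal.span {(q : MvPolynomial (Fin 3) K)}))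
    (x := fun i => Ideal.Quotient.mk _ (MvPolynomial.X i))
    (fun i => ⟨MvPolynomial.X i, MvPolynomial.isHomogeneous_X K i, rfl⟩)
    (by rintro n _ ⟨a, ha, rfl⟩; exact ⟨a, ha, hmk a⟩) m hm
  have hzero (P : MvPolynomial (Fin 3) K) : Ideal.Quotient.mkₐ K (Ideal.span {q.1}) P = 0 ↔
      q.1 ∣ P := by
    rw [Ideal.Quotient.mkₐ_eq_mk, Ideal.Quotient.eq_zero_iff_mem, Ideal.mem_span_singleton]
  refine ⟨u, i, hi, htop, ?_, fun n f hf hf0 => ?_⟩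
  · refine h1 2 q.1 q.2 ?_
    rw [hmk, hzero]
  · obtain ⟨l, hl⟩ := h2 ‹IsReduced (planeConic q).left› ‹IsDominant m› n f hf hf0
    refine ⟨l, ?_⟩
    rwa [hmk, hzero] at hl

end Coordinates

/-! ### The action of automorphisms on the function field -/

section FunctionFieldAction

open AlgebraicGeometry.Scheme

/-- An endomorphism fixing a point acts on its residue field. -/
lemma exists_residueField_map {X : Scheme.{u}} (f : X ⟶ X) {x : X} (hx : f x = x) :
    ∃ φ : X.residueField x ⟶ X.residueField x,
      Spec.map φ ≫ X.fromSpecResidueField x = X.fromSpecResidueField x ≫ f := by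
  refine ⟨(X.residueFieldCongr hx.symm).hom ≫ f.residueFieldMap x, ?_⟩
  rw [Spec.map_comp, Category.assoc, residueFieldCongr_fromSpecResidueField,
    Hom.SpecMap_residueFieldMap_fromSpecResidueField]

lemma isDominant_of_isGenericPoint {X : Scheme.{u}} {x : X} (hx : closure {x} = Set.univ) :
    IsDominant (X.fromSpecResidueField x) := by
  refine ⟨?_⟩
  rw [denseRange_iff_closure_range, range_fromSpecResidueField, hx]

lemma apply_eq_of_isGenericPoint {X : Scheme.{u}} {x : X} (hx : closure {x} = Set.univ)
    (f : X ≅ X) : f.hom x = x := by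
  have h : IsGenericPoint (f.hom x) (closure (f.hom '' Set.univ)) :=
    IsGenericPoint.image (S := Set.univ) hx f.hom.continuous
  have hsurj : f.hom '' Set.univ = Set.univ := by
    rw [Set.image_univ]
    exact f.hom.surjective.range_eq
  rw [hsurj, closure_univ] at h
  exact h.eq hx

/-- The automorphisms of a reduced separated scheme with a generic point `x` act faithfully on its
function field, realized here as the residue field `κ(x)`. Since `κ(x)` is contravariant in `X`,
the action of `g` is by pullback along `g⁻¹`. -/
theorem exists_functionField_action {k : Type u} [Field k] (X : Over (Spec (.of k)))
    [IsReduced X.left] [IsSeparated X.hom] {x : X.left} (hx : closure {x} = Set.univ)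
    [Algebra k (X.left.residueField x)]
    (hk : X.left.fromSpecResidueField x ≫ X.hom =
      Spec.map (CommRingCat.ofHom (algebraMap k (X.left.residueField x)))) :
    ∃ γ : Aut X →* (X.left.residueField x ≃ₐ[k] X.left.residueField x), Function.Injective γ ∧
      ∀ g, Spec.map (CommRingCat.ofHom (γ g : X.left.residueField x →+* X.left.residueField x)) ≫
        X.left.fromSpecResidueField x = X.left.fromSpecResidueField x ≫ g.inv.left := by
  have ex (g : Aut X) : ∃ φ : X.left.residueField x ⟶ X.left.residueField x,
      Spec.map φ ≫ X.left.fromSpecResidueField x =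
        X.left.fromSpecResidueField x ≫ g.inv.left :=
    exists_residueField_map _
      (apply_eq_of_isGenericPoint hx ((Over.forget _).mapIso (Iso.symm g)))
  choose φ hφ using ex
  have inj {φ ψ : X.left.residueField x ⟶ X.left.residueField x}
      (h : Spec.map φ ≫ X.left.fromSpecResidueField x =
        Spec.map ψ ≫ X.left.fromSpecResidueField x) : φ = ψ :=
    Spec.map_injective ((cancel_mono _).1 h)
  have hone : φ 1 = 𝟙 _ := inj (by
    rw [hφ, Spec.map_id, Category.id_comp]
    exact Category.comp_id _)
  have hmul (g h : Aut X) : φ (g * h) = φ h ≫ φ g := inj (by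
    have hgh : Over.Hom.left (Iso.inv (g * h)) = Over.Hom.left (Iso.inv g) ≫
      Over.Hom.left (Iso.inv h) := rfl
    rw [hφ, hgh, Spec.map_comp, Category.assoc, hφ, ← Category.assoc, ← hφ g, Category.assoc])
  have hcomm (g : Aut X) (c : k) : (φ g).hom (algebraMap k _ c) = algebraMap k _ c := by
    have h1 : CommRingCat.ofHom (algebraMap k (X.left.residueField x)) ≫ φ g =
        CommRingCat.ofHom (algebraMap k (X.left.residueField x)) := by
      apply Spec.map_injective
      rw [Spec.map_comp, ← hk, ← Category.assoc, hφ, Category.assoc, Over.w]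
    exact congrArg (fun f => CommRingCat.Hom.hom f c) h1
  have hinv (g : Aut X) : φ g ≫ φ g⁻¹ = 𝟙 _ := by rw [← hmul, inv_mul_cancel, hone]
  have hinv' (g : Aut X) : φ g⁻¹ ≫ φ g = 𝟙 _ := by rw [← hmul, mul_inv_cancel, hone]
  let γ : Aut X →* (X.left.residueField x ≃ₐ[k] X.left.residueField x) :=
    { toFun := fun g => AlgEquiv.ofRingEquiv
        (f := RingEquiv.ofRingHom (φ g).hom (φ g⁻¹).hom
          (congrArg CommRingCat.Hom.hom (hinv' g)) (congrArg CommRingCat.Hom.hom (hinv g)))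
        (hcomm g)
      map_one' := AlgEquiv.ext fun y => congrArg (fun f => CommRingCat.Hom.hom f y) hone
      map_mul' := fun g h => AlgEquiv.ext fun y =>
        congrArg (fun f => CommRingCat.Hom.hom f y) (hmul g h) }
  have hγ (g : Aut X) :
      CommRingCat.ofHom (γ g : X.left.residueField x →+* X.left.residueField x) = φ g := by
    ext y; rfl
  refine ⟨γ, ?_, fun g => by rw [hγ, hφ]⟩
  rw [injective_iff_map_eq_one]
  intro g hg
  have h1 : φ g = 𝟙 _ := by
    rw [← hγ, hg]; rfl
  have h2 := hφ g
  rw [h1, Spec.map_id, Category.id_comp] at h2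
  have := isDominant_of_isGenericPoint hx
  have h3 : g.inv.left = 𝟙 X.left :=
    ext_of_isDominant_of_isSeparated X.hom (by rw [Over.w, Category.id_comp])
      (X.left.fromSpecResidueField x) (by rw [Category.comp_id]; exact h2.symm)
  have h4 : g⁻¹ = 1 := Iso.ext (by
    apply Over.OverMorphism.ext
    exact h3)
  exact inv_eq_one.1 h4

/-- If `g` lies over an automorphism of `B`, its action on the function field of `X` preserves
the residue field of the image in `B` of the generic point. -/
lemma exists_apply_residueFieldMap_eq {k : Type u} [Field k] {X B : Over (Spec (.of k))}
    (π : X ⟶ B) {x : X.left} {g : X ≅ X} {h : B ≅ B} (hg : g.hom ≫ π = π ≫ h.hom)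
    {φ : X.left.residueField x ⟶ X.left.residueField x}
    (hφ : Spec.map φ ≫ X.left.fromSpecResidueField x =
      X.left.fromSpecResidueField x ≫ g.inv.left) :
    ∃ ψ : B.left.residueField (π.left x) ⟶ B.left.residueField (π.left x),
      π.left.residueFieldMap x ≫ φ = ψ ≫ π.left.residueFieldMap x := by
  have hg' : g.inv ≫ π = π ≫ h.inv := by
    rw [Iso.inv_comp_eq, ← Category.assoc, hg, Category.assoc, Iso.hom_inv_id, Category.comp_id]
  have hgl : g.inv.left ≫ π.left = π.left ≫ h.inv.left := congrArg (·.left) hg'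
  have key : Spec.map (π.left.residueFieldMap x ≫ φ) ≫ B.left.fromSpecResidueField (π.left x) =
      Spec.map (π.left.residueFieldMap x) ≫ B.left.fromSpecResidueField (π.left x) ≫
        h.inv.left := by
    rw [Spec.map_comp, Category.assoc, Hom.SpecMap_residueFieldMap_fromSpecResidueField,
      ← Category.assoc, hφ, Category.assoc, hgl,
      Hom.SpecMap_residueFieldMap_fromSpecResidueField_assoc]
  have hfix : h.inv.left (π.left x) = π.left x := by
    have := congrArg (fun f => f default) key
    simpa using this.symm
  obtain ⟨ψ, hψ⟩ := exists_residueField_map h.inv.left hfix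
  refine ⟨ψ, Spec.map_injective ((cancel_mono (B.left.fromSpecResidueField (π.left x))).1 ?_)⟩
  rw [key, Spec.map_comp, Category.assoc, hψ]

/-- The generic point of `X` is the generic point of its fibre. -/
lemma isDominant_asFiberHom {X B : Scheme.{u}} (f : X ⟶ B) {x : X} (hx : closure {x} = Set.univ) :
    IsDominant (f.asFiberHom x) := by
  refine ⟨?_⟩
  rw [denseRange_iff_closure_range, Hom.range_asFiberHom,
    (f.fiberι (f x)).isEmbedding.isInducing.closure_eq_preimage_closure_image,
    Set.image_singleton, Hom.fiberι_asFiber, hx, Set.preimage_univ]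

end FunctionFieldAction

/-! ### Conic bundles over the projective line -/

/-- A finite group acting faithfully on a conic bundle over the projective line has a normal
abelian subgroup of index at most `7200`. -/
theorem exists_abelian_index_le_of_isConicBundle {k : Type u} [Field k] [IsAlgClosed k]
    [CharZero k] {X B : Over (Spec (.of k))} [IsIntegral X.left] [IsSeparated X.hom]
    (e : B ≅ projectiveLine k) {π : X ⟶ B} (hπ : IsConicBundle π) {G : Type*} [Group G] [Finite G]
    (ρ : G →* autPreserving π) (hρ : Function.Injective ρ) :
    ∃ A : Subgroup G, A.Normal ∧ IsMulCommutative A ∧ A.index ≤ 7200 := by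
  obtain ⟨x, hx⟩ : ∃ x : X.left, closure {x} = Set.univ := ⟨_, genericPoint_closure _⟩
  -- the algebra structures `k → κ(π x) → κ(x)`
  let _ : Algebra (B.left.residueField (π.left x)) (X.left.residueField x) :=
    (π.left.residueFieldMap x).hom.toAlgebra
  let _ : Algebra k (B.left.residueField (π.left x)) :=
    (Spec.preimage (B.left.fromSpecResidueField (π.left x) ≫ B.hom)).hom.toAlgebra
  let _ : Algebra k (X.left.residueField x) :=
    ((algebraMap (B.left.residueField (π.left x)) (X.left.residueField x)).comp
      (algebraMap k (B.left.residueField (π.left x)))).toAlgebra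
  have : IsScalarTower k (B.left.residueField (π.left x)) (X.left.residueField x) :=
    IsScalarTower.of_algebraMap_eq fun _ => rfl
  have hkB : B.left.fromSpecResidueField (π.left x) ≫ B.hom =
      Spec.map (CommRingCat.ofHom (algebraMap k (B.left.residueField (π.left x)))) :=
    (Spec.map_preimage _).symm
  have hkX : X.left.fromSpecResidueField x ≫ X.hom =
      Spec.map (CommRingCat.ofHom (algebraMap k (X.left.residueField x))) := by
    have h1 : CommRingCat.ofHom (algebraMap k (X.left.residueField x)) =
        CommRingCat.ofHom (algebraMap k (B.left.residueField (π.left x))) ≫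
          π.left.residueFieldMap x := rfl
    rw [h1, Spec.map_comp, ← hkB, Scheme.Hom.SpecMap_residueFieldMap_fromSpecResidueField_assoc,
      Over.w]
  -- the base
  have : IsIso e.hom.left := ((Over.forget _).mapIso e).isIso_hom
  have : IsPreimmersion (X := Spec (.of (B.left.residueField (π.left x))))
      (B.left.fromSpecResidueField (π.left x) ≫ e.hom.left) :=
    IsPreimmersion.comp (B.left.fromSpecResidueField (π.left x)) e.hom.left
  obtain ⟨s, hs⟩ := exists_adjoin_eq_top_of_projectiveLine (K := k)
    (L := B.left.residueField (π.left x))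
    (B.left.fromSpecResidueField (π.left x) ≫ e.hom.left)
    (by rw [Category.assoc, Over.w]; exact hkB)
  -- the generic fibre
  obtain ⟨q, hq0, hred, ⟨c⟩⟩ := hπ (π.left x)
  have := isDominant_asFiberHom π.left hx
  have : IsIso (X := π.left.fiber (π.left x)) c.hom.left := ((Over.forget _).mapIso c).isIso_hom
  have : IsPreimmersion (X := Spec (.of (X.left.residueField x)))
      (π.left.asFiberHom x ≫ c.hom.left) :=
    IsPreimmersion.comp (Y := π.left.fiber (π.left x)) (π.left.asFiberHom x) c.hom.left
  have : IsDominant (X := Spec (.of (X.left.residueField x)))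
      (π.left.asFiberHom x ≫ c.hom.left) :=
    inferInstanceAs (IsDominant (CategoryStruct.comp (Y := π.left.fiber (π.left x))
      (π.left.asFiberHom x) c.hom.left))
  obtain ⟨v, i, hi, htop, hv, hdvd⟩ := exists_coordinates_of_planeConic
    (L := X.left.residueField x) q (π.left.asFiberHom x ≫ c.hom.left)
    (by
      rw [Category.assoc, Over.w]
      exact π.left.asFiberHom_fiberToSpecResidueField x)
  have : CharZero (B.left.residueField (π.left x)) :=
    charZero_of_injective_algebraMap (algebraMap k (B.left.residueField (π.left x))).injective
  obtain ⟨F, hfin, hF, t, ht, hFt⟩ := exists_generator_of_conic hs q.2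
    (fun h => hq0 (Subtype.ext h)) hi hv htop hdvd
  -- the group action
  obtain ⟨γ, hγ, hγX⟩ := exists_functionField_action X hx hkX
  refine exists_abelian_index_le hs F hF ht hFt (γ.comp ((autPreserving π).subtype.comp ρ))
    (hγ.comp (Subtype.val_injective.comp hρ)) fun g y => ?_
  obtain ⟨h, hh⟩ := (ρ g).2
  obtain ⟨ψ, hψ⟩ := exists_apply_residueFieldMap_eq π hh (hγX (ρ g).1)
  exact ⟨ψ.hom y, congrArg (fun f => CommRingCat.Hom.hom f y) hψ⟩

theorem mainTheorem5 (k : Type u) [Field k] [IsAlgClosed k] [CharZero k]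
    (X B : Over (Spec (.of k))) (hX : IsSmoothSurface X) (hrat : Scheme.IsRationalOver X.hom)
    (hB : Nonempty (B ≅ projectiveLine k)) (π : X ⟶ B) (hπ : IsConicBundle π) :
    IsJordanGroup (autPreserving π) ∧ jordanConstant (autPreserving π) ≤ 7200 := by
  have := hX.isIntegral
  have := hX.isSeparated
  obtain ⟨e⟩ := hB
  have hJ : JordanBound (autPreserving π) 7200 := fun G _ =>
    exists_abelian_index_le_of_isConicBundle e hπ G.subtype Subtype.val_injective
  exact ⟨⟨7200, by norm_num, hJ⟩, Nat.sInf_le ⟨by norm_num, hJ⟩⟩
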